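/- Let $\mathcal H$ be the upper half-plane, let $p\ge 1$ be an integer, and let $k>2$ be a real number. Write $z^s=|z|^s e^{is\arg z}$ with $\arg z\in\left]-\pi,\pi\right]$ for $z\in\mathbb C^\times$, $s\in\mathbb R$, and $j(\gamma,\tau)=c\tau+d$ for $\gamma=\begin{pmatrix}a&b\\c&d\end{pmatrix}$. Let $v:\mathrm{SL}_2(\mathbb Z)\to\{z\in\mathbb C:|z|=1\}$ be a unitary multiplier system of weight $k$, i.e. $\mu(\gamma,\tau)=v(\gamma)j(\gamma,\tau)^k$ satisfies $\mu(\gamma_1\gamma_2,\tau)=\mu(\gamma_1,\gamma_2.\tau)\mu(\gamma_2,\tau)$ for all $\gamma_1,\gamma_2\in\mathrm{SL}_2(\mathbb Z)$, $\tau\in\mathcal H$, and suppose that $v(-I_2)=(-1)^{-k}$. For a function $F$ on $\mathcal H$ with values in $\mathbb C$ or $\mathbb C^p$ put $(F|_k\gamma)(\tau)=v(\gamma)^{-1}j(\gamma,\tau)^{-k}F(\gamma.\tau)$. Let $\Gamma\ni -I_2$ be a subgroup of finite index in $\mathrm{SL}_2(\mathbb Z)$, and let $\rho:\Gamma\to\mathrm{GL}_p(\mathbb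 C)$ be a unitary representation that is normal, i.e. $\rho(-I_2)=I_p$ and, with $T=\begin{pmatrix}1&1\\0&1\end{pmatrix}$, for all $\sigma\in\mathrm{SL}_2(\mathbb Z)$ and integers $M\ge1$ with $\sigma T^M\sigma^{-1}\in\Gamma$ there is an integer $N\ge 1$ with $\left(v(T)^M\rho(\sigma T^M\sigma^{-1})\right)^N=I_p$. Let $\mathcal S(k,\rho,\Gamma)$ be the space of functions $F=(F_1,\dots,F_p):\mathcal H\to\mathbb C^p$ with holomorphic components such that $F|_k\gamma=\rho(\gamma)F$ for all $\gamma\in\Gamma$ and such that, for every $j$ and every $\sigma\in\mathrm{SL}_2(\mathbb Z)$, the function $F_j|_k\sigma$ has an expansion $\sum_{n\ge1}a_n e^{2\pi i n\tau/N}$ on $\mathcal H$ for some integer $N\ge1$ and some $a_n\in\mathbb C$ ($N$ and $a_n$ may depend on $j$ and $\sigma$). For $\xi\in\mathcal H$, an integer $\nu\ge0$ and $u\in\mathbb C^p$, the elliptic Poincaré series is $$\Phi_{k,\rho,\Gamma,\nu,\xi,u}=\sum_{\gamma\in\langle -I_2\rangle\backslash\Gamma}\rho(\gamma)^{-1}\left(f|_k\gamma\right),\qquad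 f(\tau)=\frac{(\tau-\xi)^\nu}{(\tau-\overline\xi)^{\nu+k}}\,u .$$ Then for every $\xi\in\mathcal H$ the series $\Phi_{k,\rho,\Gamma,\nu,\xi,e_j}$, for integers $\nu\ge0$ and $1\le j\le p$ (where $e_1,\dots,e_p$ is the standard basis of $\mathbb C^p$), converge absolutely at every point of $\mathcal H$, and $$\mathcal S(k,\rho,\Gamma)=\mathrm{span}_{\mathbb C}\left\{\Phi_{k,\rho,\Gamma,\nu,\xi,e_j}:\nu\in\mathbb Z_{\ge0},\ 1\le j\le p\right\}.$$ -/

import Mathlib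

open UpperHalfPlane ModularGroup
open scoped MatrixGroups Manifold

noncomputable section

namespace VVMF

/-- A unitary multiplier system for `SL(2, ℤ)` of real weight `k`, subject to the nontriviality
condition `v(-I) = (-1)^(-k)`. Complex powers use the branch of the argument in `(-π, π]`, and
`denom γ τ = c τ + d`. -/
structure IsMultiplierSystem (k : ℝ) (v : SL(2, ℤ) → ℂ) : Prop where
  norm_eq_one : ∀ γ, ‖v γ‖ = 1
  cocycle : ∀ (γ₁ γ₂ : SL(2, ℤ)) (τ : ℍ),
    v (γ₁ * γ₂) * denom (γ₁ * γ₂ : SL(2, ℤ)) τ ^ (k : ℂ) =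
      (v γ₁ * denom γ₁ (γ₂ • τ : ℍ) ^ (k : ℂ)) * (v γ₂ * denom γ₂ τ ^ (k : ℂ))
  neg_one : v (-1) = (-1 : ℂ) ^ (-(k : ℂ))

/-- The action `(F|_k γ)(τ) = v(γ)⁻¹ (c τ + d)^(-k) F(γ.τ)` on functions `ℍ → E`. -/
def slash {E : Type*} [SMul ℂ E] (k : ℝ) (v : SL(2, ℤ) → ℂ) (γ : SL(2, ℤ)) (F : ℍ → E) : ℍ → E :=
  fun τ ↦ ((v γ)⁻¹ * denom γ τ ^ (-(k : ℂ))) • F (γ • τ)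

/-- `g(τ) = ∑_{n ≥ 1} a_n exp(2 π i n τ / N)` on the upper half-plane for some integer `N ≥ 1`. -/
def HasCuspidalFourierExpansion (g : ℍ → ℂ) : Prop :=
  ∃ N : ℕ, 0 < N ∧ ∃ a : ℕ → ℂ, a 0 = 0 ∧ ∀ τ : ℍ,
    HasSum (fun n : ℕ ↦ a n * Complex.exp (2 * Real.pi * Complex.I * (n / N) * τ)) (g τ)

lemma HasCuspidalFourierExpansion.of_mul {g : ℍ → ℂ} {N : ℕ} {a : ℕ → ℂ} (ha : a 0 = 0)
    (hs : ∀ τ : ℍ,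
      HasSum (fun n : ℕ ↦ a n * Complex.exp (2 * Real.pi * Complex.I * (n / N) * τ)) (g τ))
    {M : ℕ} (hM : 0 < M) :
    ∃ b : ℕ → ℂ, b 0 = 0 ∧ ∀ τ : ℍ, HasSum (fun n : ℕ ↦
      b n * Complex.exp (2 * Real.pi * Complex.I * (n / (N * M : ℕ)) * τ)) (g τ) := by
  refine ⟨fun n ↦ if M ∣ n then a (n / M) else 0, by simp [ha], fun τ ↦ ?_⟩
  have hinj : Function.Injective (fun n : ℕ ↦ n * M) := fun x y h ↦
    Nat.eq_of_mul_eq_mul_right hM h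
  rw [← hinj.hasSum_iff]
  · convert hs τ using 2 with n
    have hM' : (M : ℂ) ≠ 0 := by exact_mod_cast hM.ne'
    simp only [Function.comp, dvd_mul_left, if_true, Nat.mul_div_cancel _ hM, Nat.cast_mul]
    rw [mul_div_mul_right _ _ hM']
  · intro n hn
    have : ¬ M ∣ n := fun ⟨c, hc⟩ ↦ hn ⟨c, by simp [hc, mul_comm]⟩
    simp [this]

lemma HasCuspidalFourierExpansion.add {f g : ℍ → ℂ} (hf : HasCuspidalFourierExpansion f)
    (hg : HasCuspidalFourierExpansion g) : HasCuspidalFourierExpansion (f + g) := by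
  obtain ⟨N, hN, a, ha, hfa⟩ := hf
  obtain ⟨M, hM, b, hb, hgb⟩ := hg
  obtain ⟨a', ha', hfa'⟩ := of_mul ha hfa hM
  obtain ⟨b', hb', hgb'⟩ := of_mul hb hgb hN
  refine ⟨N * M, Nat.mul_pos hN hM, a' + b', by simp [ha', hb'], fun τ ↦ ?_⟩
  rw [mul_comm M N] at hgb'
  simpa [add_mul] using (hfa' τ).add (hgb' τ)

lemma HasCuspidalFourierExpansion.smul {f : ℍ → ℂ} (c : ℂ) (hf : HasCuspidalFourierExpansion f) :
    HasCuspidalFourierExpansion (c • f) := by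
  obtain ⟨N, hN, a, ha, hfa⟩ := hf
  exact ⟨N, hN, c • a, by simp [ha], fun τ ↦ by simpa [mul_assoc] using (hfa τ).mul_left c⟩

/-- The space `S(k)` of holomorphic functions on the upper half-plane all of whose translates
`f|_k σ`, `σ ∈ SL(2, ℤ)`, have a Fourier expansion supported on positive exponents. -/
def cuspSpace (k : ℝ) (v : SL(2, ℤ) → ℂ) : Submodule ℂ (ℍ → ℂ) where
  carrier := {f | MDifferentiable 𝓘(ℂ) 𝓘(ℂ) f ∧
    ∀ σ : SL(2, ℤ), HasCuspidalFourierExpansion (slash k v σ f)}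
  zero_mem' := ⟨mdifferentiable_const, fun σ ↦
    ⟨1, one_pos, 0, rfl, fun τ ↦ by simp [slash]⟩⟩
  add_mem' hf hg := ⟨hf.1.add hg.1, fun σ ↦ by
    convert (hf.2 σ).add (hg.2 σ) using 1
    ext τ
    simp [slash, mul_add]⟩
  smul_mem' c f hf := ⟨hf.1.const_smul c, fun σ ↦ by
    convert (hf.2 σ).smul c using 1
    ext τ
    simp only [slash, smul_eq_mul, Pi.smul_apply]
    ring⟩

variable {p : ℕ} {Γ : Subgroup SL(2, ℤ)}

/-- The space `S(k, ρ, Γ)` of cuspidal vector-valued modular forms: functions `ℍ → ℂ^p` with all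
components in `S(k)` and with `F|_k γ = ρ(γ) F` for all `γ ∈ Γ`. -/
def cuspForms (k : ℝ) (v : SL(2, ℤ) → ℂ) (ρ : Γ →* GL (Fin p) ℂ) :
    Submodule ℂ (ℍ → Fin p → ℂ) where
  carrier := {F | (∀ j, (fun τ ↦ F τ j) ∈ cuspSpace k v) ∧
    ∀ (γ : Γ) (τ : ℍ), slash k v γ F τ = (ρ γ : Matrix (Fin p) (Fin p) ℂ).mulVec (F τ)}
  zero_mem' := ⟨fun _ ↦ (cuspSpace k v).zero_mem, fun γ τ ↦ by simp [slash]⟩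
  add_mem' hF hG := ⟨fun j ↦ (cuspSpace k v).add_mem (hF.1 j) (hG.1 j), fun γ τ ↦ by
    have h1 := hF.2 γ τ
    have h2 := hG.2 γ τ
    simp only [slash, Pi.add_apply, smul_add, Matrix.mulVec_add] at *
    rw [h1, h2]⟩
  smul_mem' c F hF := ⟨fun j ↦ (cuspSpace k v).smul_mem c (hF.1 j), fun γ τ ↦ by
    have h1 := hF.2 γ τ
    simp only [slash, Pi.smul_apply, Matrix.mulVec_smul] at *
    rw [smul_comm, h1]⟩

/-- A unitary representation `Γ → U(p) ⊆ GL(p, ℂ)`. -/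
def IsUnitary (ρ : Γ →* GL (Fin p) ℂ) : Prop :=
  ∀ γ : Γ, (ρ γ : Matrix (Fin p) (Fin p) ℂ) ∈ Matrix.unitaryGroup (Fin p) ℂ

/-- A normal representation of `Γ ∋ -I`: `ρ(-I) = I`, and `exp(2 π i κ M) ρ(σ T^M σ⁻¹)` has finite
order whenever `σ ∈ SL(2, ℤ)`, `M ≥ 1` and `σ T^M σ⁻¹ ∈ Γ`. Here `κ` is given by
`v(T) = exp(2 π i κ)`, so the scalar is `v(T)^M`. -/
structure IsNormal (v : SL(2, ℤ) → ℂ) (hΓ : -1 ∈ Γ) (ρ : Γ →* GL (Fin p) ℂ) : Prop where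
  neg_one : ρ ⟨-1, hΓ⟩ = 1
  finite_order : ∀ (σ : SL(2, ℤ)) (M : ℕ), 0 < M → ∀ h : σ * T ^ M * σ⁻¹ ∈ Γ,
    ∃ N : ℕ, 0 < N ∧
      (v T ^ M • (ρ ⟨σ * T ^ M * σ⁻¹, h⟩ : Matrix (Fin p) (Fin p) ℂ)) ^ N = 1

/-- The action `F|_{k,ρ} γ = ρ(γ)⁻¹ (F|_k γ)` of `Γ` on functions `ℍ → ℂ^p`. -/
def slashRep (k : ℝ) (v : SL(2, ℤ) → ℂ) (ρ : Γ →* GL (Fin p) ℂ) (γ : Γ) (F : ℍ → Fin p → ℂ) :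
    ℍ → Fin p → ℂ :=
  fun τ ↦ ((ρ γ)⁻¹ : GL (Fin p) ℂ).val.mulVec (slash k v γ F τ)

lemma slashRep_mul {k : ℝ} {v : SL(2, ℤ) → ℂ} (hv : IsMultiplierSystem k v)
    (ρ : Γ →* GL (Fin p) ℂ) (γ₁ γ₂ : Γ) (F : ℍ → Fin p → ℂ) :
    slashRep k v ρ (γ₁ * γ₂) F = slashRep k v ρ γ₂ (slashRep k v ρ γ₁ F) := by
  ext1 τ
  have h := congrArg (·⁻¹) (hv.cocycle γ₁ γ₂ τ)
  simp only [mul_inv, ← Complex.cpow_neg, map_mul] at h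
  simp only [slashRep, slash, map_mul, mul_inv_rev, Units.val_mul, ← Matrix.mulVec_mulVec,
    Matrix.mulVec_smul, smul_smul, Subgroup.coe_mul]
  rw [show ((γ₁ : SL(2, ℤ)) * (γ₂ : SL(2, ℤ))) • τ = (γ₁ : SL(2, ℤ)) • ((γ₂ : SL(2, ℤ)) • τ) from
    SemigroupAction.mul_smul _ _ _, h, mul_comm]

/-- The Poincaré series `P_{Λ\Γ,ρ} f = ∑_{γ ∈ Λ\Γ} f|_{k,ρ} γ`, a sum over the right cosets `Λ γ`,
for functions `f` with `f|_{k,ρ} λ = f` for all `λ ∈ Λ`. For such `f` the summand does not depend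
on the choice of the representative, see `slashRep_out_eq`. -/
def poincareSeries (k : ℝ) (v : SL(2, ℤ) → ℂ) (ρ : Γ →* GL (Fin p) ℂ) (Λ : Subgroup Γ)
    (f : ℍ → Fin p → ℂ) : ℍ → Fin p → ℂ :=
  fun τ ↦ ∑' c : Quotient (QuotientGroup.rightRel Λ), slashRep k v ρ c.out f τ

lemma slashRep_out_eq {k : ℝ} {v : SL(2, ℤ) → ℂ} (hv : IsMultiplierSystem k v)
    (ρ : Γ →* GL (Fin p) ℂ) (Λ : Subgroup Γ) (f : ℍ → Fin p → ℂ)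
    (hf : ∀ l ∈ Λ, slashRep k v ρ l f = f) (γ : Γ) :
    slashRep k v ρ (Quotient.mk (QuotientGroup.rightRel Λ) γ).out f = slashRep k v ρ γ f := by
  have h := Quotient.mk_out (s := QuotientGroup.rightRel Λ) γ
  have h' := QuotientGroup.rightRel_apply.mp h
  conv_rhs => rw [show γ = γ * (Quotient.mk (QuotientGroup.rightRel Λ) γ).out⁻¹ *
    (Quotient.mk (QuotientGroup.rightRel Λ) γ).out by group]
  rw [slashRep_mul hv, hf _ h']

/-- The function `τ ↦ (τ - ξ)^ν / (τ - conj ξ)^(ν + k) u`. -/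
def ellipticSeed (k : ℝ) (ν : ℕ) (ξ : ℍ) (u : Fin p → ℂ) : ℍ → Fin p → ℂ :=
  fun τ ↦ (((τ : ℂ) - ξ) ^ ν / ((τ : ℂ) - (starRingEnd ℂ) ξ) ^ ((ν : ℂ) + k)) • u

/-- Functions on `ℍ` are invariant under `⟨-I⟩`, so that sums over `⟨-I⟩\Γ` make sense. -/
lemma slashRep_eq_self_of_mem_zpowers {k : ℝ} {v : SL(2, ℤ) → ℂ} (hv : IsMultiplierSystem k v)
    (hΓ : -1 ∈ Γ) (ρ : Γ →* GL (Fin p) ℂ) (hρ : ρ ⟨-1, hΓ⟩ = 1) (f : ℍ → Fin p → ℂ) :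
    ∀ l ∈ Subgroup.zpowers (⟨-1, hΓ⟩ : Γ), slashRep k v ρ l f = f := by
  have h1 : slashRep k v ρ ⟨-1, hΓ⟩ f = f := by
    ext1 τ
    have h : ((-1 : SL(2, ℤ)) • τ : ℍ) = τ := by simp
    have h2 : denom ((-1 : SL(2, ℤ)) : GL (Fin 2) ℝ) τ = -1 := by simp [denom]
    simp only [slashRep, slash, hρ, h, h2, hv.neg_one]
    simp
  have hsq : (⟨-1, hΓ⟩ : Γ) * ⟨-1, hΓ⟩ = 1 := by ext1; simp
  have h0 : slashRep k v ρ 1 f = f := by rw [← hsq, slashRep_mul hv, h1, h1]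
  rintro l ⟨n, rfl⟩
  rcases Int.even_or_odd' n with ⟨m, rfl | rfl⟩
  · simp only [zpow_mul]; rw [zpow_two, hsq, one_zpow, h0]
  · simp only [zpow_add, zpow_mul, zpow_one]; rw [zpow_two, hsq, one_zpow, one_mul, h1]

/-- The elliptic Poincaré series `Φ_{k,ρ,Γ,ν,ξ,u}`, a sum over `⟨-I⟩\Γ`. -/
def ellipticPoincare (k : ℝ) (v : SL(2, ℤ) → ℂ) (hΓ : -1 ∈ Γ) (ρ : Γ →* GL (Fin p) ℂ)
    (ν : ℕ) (ξ : ℍ) (u : Fin p → ℂ) : ℍ → Fin p → ℂ :=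
  poincareSeries k v ρ (Subgroup.zpowers ⟨-1, hΓ⟩) (ellipticSeed k ν ξ u)

end VVMF

end

noncomputable section

namespace VVMF

/-! ### The slash action: composition, invariant norm, holomorphy, translations. -/

section Slash

variable {E : Type*} {k : ℝ} {v : SL(2, ℤ) → ℂ}

/-! Orthogonality. In the disc coordinate `w = (τ - ξ) / (τ - conj ξ)` the seed of index `ν` is `w ^
ν` times a factor that does not depend on `ν`. Unfolding the Petersson product of a cusp form `F`
with the series attached to `ν` and `e_j` gives, up to a nonzero constant, the integral of `(1 -
|w|²)^(k - 2) conj(w)^ν G_j(w)` over the unit disc, where `G_j` is the holomorphic function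
corresponding to `F_j`. In polar coordinates this is a positive multiple of the `ν`-th Taylor
coefficient of `G_j` at `0`. Hence a cusp form orthogonal to all the series is zero
(`petersson_groupSeries`, `eq_zero_of_integral_peterssonDensity`). In a finite-dimensional inner
product space, a subspace with trivial orthogonal complement is the whole space.

Convergence. On vertical strips the terms are dominated by multiples of `(a² + b² + c² +
d²)^(-k/2)`, which is summable over `SL(2, ℤ)` for `k > 2` (`summable_entrySq_rpow`,
`exists_summable_bound`). This majorant also yields holomorphy and, by dominated convergence,
vanishing at the cusps. Normality of `ρ` supplies the period of each translate (`exists_period`).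

Finite dimension. `|F| y^(k/2)` is bounded, and if enough Fourier coefficients of `F` vanish at
every cusp, the Schwarz lemma halves any bound for it, so `F = 0` (`exists_sturm_bound`).

Two devices simplify the unfolding. The series are summed over all of `Γ` (`groupSeries`), which
only multiplies them by the order of `⟨-I⟩`. Integration over a fundamental domain is replaced by
integration over `ℍ` against a positive integrable `weight` whose `Γ`-translates sum to `1`. -/

lemma slash_mul [MulAction ℂ E] (hv : IsMultiplierSystem k v) (γ₁ γ₂ : SL(2, ℤ)) (F : ℍ → E) :
    slash k v (γ₁ * γ₂) F = slash k v γ₂ (slash k v γ₁ F) := by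
  ext1 τ
  have h := congrArg (·⁻¹) (hv.cocycle γ₁ γ₂ τ)
  simp only [mul_inv, ← Complex.cpow_neg] at h
  simp only [slash, smul_smul]
  rw [show (γ₁ * γ₂) • τ = γ₁ • (γ₂ • τ) from SemigroupAction.mul_smul _ _ _, h, mul_comm]

lemma IsMultiplierSystem.ne_zero (hv : IsMultiplierSystem k v) (γ : SL(2, ℤ)) : v γ ≠ 0 := by
  intro h
  simpa [h] using hv.norm_eq_one γ

lemma norm_slash [NormedAddCommGroup E] [NormedSpace ℂ E] (hv : IsMultiplierSystem k v)
    (γ : SL(2, ℤ)) (F : ℍ → E) (τ : ℍ) :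
    ‖slash k v γ F τ‖ = ‖denom γ τ‖ ^ (-k) * ‖F (γ • τ)‖ := by
  rw [slash, norm_smul, norm_mul, norm_inv, hv.norm_eq_one, inv_one, one_mul,
    ← Complex.ofReal_neg, Complex.norm_cpow_real]

lemma im_smul_rpow (γ : SL(2, ℤ)) (τ : ℍ) (s : ℝ) :
    (γ • τ).im ^ s = ‖denom γ τ‖ ^ (-(2 * s)) * τ.im ^ s := by
  rw [ModularGroup.im_smul_eq_div_normSq, Complex.normSq_eq_norm_sq,
    Real.div_rpow τ.im_pos.le (by positivity), ← Real.rpow_natCast, ← Real.rpow_mul (norm_nonneg _),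
    Real.rpow_neg (norm_nonneg _), mul_comm, div_eq_inv_mul]
  push_cast
  ring_nf

/-- Since `v` is unitary, `|F| y^(k/2)` is transported by `γ` without any factor; all growth
estimates are made for this quantity. -/
lemma norm_slash_mul_im_rpow [NormedAddCommGroup E] [NormedSpace ℂ E]
    (hv : IsMultiplierSystem k v) (γ : SL(2, ℤ)) (F : ℍ → E) (τ : ℍ) :
    ‖slash k v γ F τ‖ * τ.im ^ (k / 2) = ‖F (γ • τ)‖ * (γ • τ).im ^ (k / 2) := by
  rw [norm_slash hv, im_smul_rpow, mul_div_cancel₀ _ two_ne_zero]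
  ring

/-- The branch cut is harmless: for `c = 0` the base is constant, and otherwise its imaginary part
`c y` never vanishes. -/
lemma mdifferentiable_denom_cpow (γ : SL(2, ℤ)) (s : ℂ) :
    MDifferentiable 𝓘(ℂ) 𝓘(ℂ) (fun τ : ℍ ↦ denom γ τ ^ s) := by
  by_cases hc : γ 1 0 = 0
  · simp only [ModularGroup.denom_apply, hc]
    simpa using mdifferentiable_const
  · intro τ
    have hslit : denom γ τ ∈ Complex.slitPlane := by
      refine Complex.mem_slitPlane_iff.mpr (Or.inr ?_)
      have : (denom γ τ).im = γ 1 0 * τ.im := by simp [ModularGroup.denom_apply]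
      rw [this]
      exact mul_ne_zero (by exact_mod_cast hc) τ.im_ne_zero
    have h1 : DifferentiableAt ℂ (fun z : ℂ ↦ z ^ s) (denom γ τ) :=
      differentiableAt_id.cpow_const hslit
    exact h1.mdifferentiableAt.comp τ (mdifferentiable_denom γ τ)

lemma mdifferentiable_slash {f : ℍ → ℂ} (hf : MDifferentiable 𝓘(ℂ) 𝓘(ℂ) f) (γ : SL(2, ℤ)) :
    MDifferentiable 𝓘(ℂ) 𝓘(ℂ) (slash k v γ f) := by
  have h1 : MDifferentiable 𝓘(ℂ) 𝓘(ℂ) (fun τ : ℍ ↦ γ • τ) :=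
    mdifferentiable_smul (g := (γ : GL (Fin 2) ℝ)) (by simp)
  exact (((mdifferentiable_denom_cpow γ _).const_smul (v γ)⁻¹)).mul (hf.comp h1)

lemma slash_apply_comp {p : ℕ} (γ : SL(2, ℤ)) (F : ℍ → Fin p → ℂ) (τ : ℍ) (j : Fin p) :
    slash k v γ F τ j = slash k v γ (fun τ ↦ F τ j) τ := rfl

lemma denom_T_pow (M : ℕ) (τ : ℍ) : denom (T ^ M : SL(2, ℤ)) τ = 1 := by
  have h := ModularGroup.coe_T_zpow M
  rw [zpow_natCast] at h
  rw [ModularGroup.denom_apply, h]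
  simp

lemma T_pow_smul (M : ℕ) (τ : ℍ) : (T ^ M : SL(2, ℤ)) • τ = (M : ℝ) +ᵥ τ := by
  have := modular_T_zpow_smul τ M
  simpa using this

lemma IsMultiplierSystem.map_T_pow (hv : IsMultiplierSystem k v) (M : ℕ) :
    v (T ^ M) = v T ^ M := by
  have h1 : ∀ a b : ℕ, v (T ^ (a + b)) = v (T ^ a) * v (T ^ b) := fun a b ↦ by
    have := hv.cocycle (T ^ a) (T ^ b) UpperHalfPlane.I
    simpa only [← pow_add, denom_T_pow, Complex.one_cpow, mul_one] using this
  induction M with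
  | zero =>
    have := h1 0 0
    rw [add_zero] at this
    simpa using (mul_eq_left₀ (hv.ne_zero (T ^ 0))).mp this.symm
  | succ n ih => rw [h1, ih, pow_one, pow_succ]

end Slash

end VVMF
end

noncomputable section

namespace VVMF

/-! ### Convergence: comparison of the kernel with the entries of `γ`. -/

section Convergence

/-- The sum of the squares of the entries of `γ`. -/
def entrySq (γ : SL(2, ℤ)) : ℝ :=
  (γ 0 0 : ℝ) ^ 2 + (γ 0 1 : ℝ) ^ 2 + (γ 1 0 : ℝ) ^ 2 + (γ 1 1 : ℝ) ^ 2

/-- `|c τ + d| |γ.τ - conj ξ|`, the inverse of the kernel of elliptic Poincaré series. -/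
def kernelNorm (ξ : ℍ) (γ : SL(2, ℤ)) (τ : ℍ) : ℝ :=
  ‖denom γ τ‖ * ‖((γ • τ : ℍ) : ℂ) - (starRingEnd ℂ) ξ‖

lemma sub_conj_ne_zero (τ ξ : ℍ) : (τ : ℂ) - (starRingEnd ℂ) ξ ≠ 0 := by
  intro h
  have := congrArg Complex.im h
  simp only [Complex.sub_im, Complex.conj_im, coe_im, sub_neg_eq_add, Complex.zero_im] at this
  linarith [τ.im_pos, ξ.im_pos]

lemma kernelNorm_pos (ξ : ℍ) (γ : SL(2, ℤ)) (τ : ℍ) : 0 < kernelNorm ξ γ τ :=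
  mul_pos (norm_pos_iff.mpr (denom_ne_zero _ _)) (norm_pos_iff.mpr (sub_conj_ne_zero _ _))

lemma det_entries (γ : SL(2, ℤ)) :
    (γ 0 0 : ℝ) * γ 1 1 - (γ 0 1 : ℝ) * γ 1 0 = 1 := by
  have := γ.det_coe
  rw [Matrix.det_fin_two] at this
  exact_mod_cast this

lemma entrySq_pos (γ : SL(2, ℤ)) : 0 < entrySq γ := by
  have := det_entries γ
  unfold entrySq
  nlinarith [sq_nonneg ((γ 0 0 : ℝ) - γ 1 1), sq_nonneg ((γ 0 1 : ℝ) + γ 1 0)]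

lemma denom_mul_coe_smul (γ : SL(2, ℤ)) (τ : ℍ) :
    denom γ τ * ((γ • τ : ℍ) : ℂ) = γ 0 0 * τ + γ 0 1 := by
  have h := denom_ne_zero (γ : GL (Fin 2) ℝ) τ
  rw [coe_specialLinearGroup_apply]
  rw [ModularGroup.denom_apply] at h ⊢
  simp only [algebraMap_int_eq, eq_intCast, Complex.ofReal_intCast]
  field_simp

/-- Clearing the denominator turns the kernel into `|(a - conj ξ c) τ + (b - conj ξ d)|`. The
determinant reduces the cross term of the square to `2 Im τ Im ξ`, so that the square becomes a sum
of nonnegative terms. -/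
lemma kernelNorm_sq (ξ : ℍ) (γ : SL(2, ℤ)) (τ : ℍ) :
    kernelNorm ξ γ τ ^ 2 =
      ((γ 0 0 - ξ.re * γ 1 0) * τ.re + (γ 0 1 - ξ.re * γ 1 1)) ^ 2 +
        ξ.im ^ 2 * (γ 1 0 * τ.re + γ 1 1) ^ 2 +
        τ.im ^ 2 * ((γ 0 0 - ξ.re * γ 1 0) ^ 2 + ξ.im ^ 2 * γ 1 0 ^ 2) +
        2 * τ.im * ξ.im := by
  have hdet := det_entries γ
  rw [kernelNorm, ← norm_mul, mul_sub, denom_mul_coe_smul, ← Complex.normSq_eq_norm_sq,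
    Complex.normSq_apply, ModularGroup.denom_apply]
  simp only [Complex.sub_re, Complex.add_re, Complex.mul_re, Complex.intCast_re, coe_re,
    Complex.intCast_im, coe_im, Complex.conj_re, Complex.conj_im, Complex.add_im, Complex.mul_im,
    Complex.sub_im]
  linear_combination (2 * τ.im * ξ.im) * hdet

/-- The shear `(p, q) ↦ (p - u q, w q)` is invertible, hence bounded below. It is applied to the
columns of `γ` with `u + i w = ξ`. -/
lemma sq_add_sq_le_shear (u : ℝ) {w : ℝ} (hw : 0 < w) (p q : ℝ) :
    p ^ 2 + q ^ 2 ≤ (2 + (2 * u ^ 2 + 1) / w ^ 2) * ((p - u * q) ^ 2 + w ^ 2 * q ^ 2) := by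
  have i1 : p ^ 2 ≤ 2 * (p - u * q) ^ 2 + 2 * u ^ 2 * q ^ 2 := by
    linarith [sq_nonneg ((p - u * q) - u * q)]
  have i2 : (2 * u ^ 2 + 1) / w ^ 2 * ((p - u * q) ^ 2 + w ^ 2 * q ^ 2) =
      (2 * u ^ 2 + 1) / w ^ 2 * (p - u * q) ^ 2 + (2 * u ^ 2 + 1) * q ^ 2 := by
    field_simp
  have i3 : 0 ≤ (2 * u ^ 2 + 1) / w ^ 2 * (p - u * q) ^ 2 := by positivity
  have i4 : 0 ≤ w ^ 2 * q ^ 2 := by positivity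
  rw [add_mul, i2]
  linarith

lemma exists_mul_entrySq_le (ξ : ℍ) (A : ℝ) {B : ℝ} (hB : 0 < B) :
    ∃ C : ℝ, 0 < C ∧ ∀ (γ : SL(2, ℤ)), ∀ τ ∈ verticalStrip A B,
      C * entrySq γ ≤ kernelNorm ξ γ τ ^ 2 := by
  have hw := ξ.im_pos
  set w := ξ.im
  set u := ξ.re
  have hK : 0 < (2 + (2 * u ^ 2 + 1) / w ^ 2) * (1 / B ^ 2 + (2 + 2 * A ^ 2 / B ^ 2)) := by
    positivity
  refine ⟨_, inv_pos.mpr hK, fun γ τ hτ ↦ ?_⟩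
  rw [inv_mul_le_iff₀ hK, kernelNorm_sq, entrySq]
  obtain ⟨hx, hy⟩ := hτ
  generalize (γ 0 0 : ℝ) = a
  generalize (γ 0 1 : ℝ) = b
  generalize (γ 1 0 : ℝ) = c
  generalize (γ 1 1 : ℝ) = d
  have hyp := τ.im_pos
  generalize τ.re = x at *
  generalize τ.im = y at *
  have hx2 : x ^ 2 ≤ A ^ 2 := sq_le_sq' (by linarith [neg_abs_le x]) (by linarith [le_abs_self x])
  have hy2 : B ^ 2 ≤ y ^ 2 := by gcongr
  -- `P` and `P'` are the squared norms of the sheared columns, `Q` is the squared kernel. The term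
  -- `y² P` of `Q` controls the first column; the second is recovered from it and the remaining
  -- squares using `|x| ≤ A`.
  set P := (a - u * c) ^ 2 + w ^ 2 * c ^ 2 with hP
  set P' := (b - u * d) ^ 2 + w ^ 2 * d ^ 2 with hP'
  set Q := ((a - u * c) * x + (b - u * d)) ^ 2 + w ^ 2 * (c * x + d) ^ 2 + y ^ 2 * P + 2 * y * w
    with hQ
  have hP0 : 0 ≤ P := by positivity
  have hP0' : 0 ≤ P' := by positivity
  have h1 : P ≤ 1 / B ^ 2 * Q := by
    rw [div_mul_eq_mul_div, one_mul, le_div_iff₀ (by positivity)]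
    have := mul_le_mul_of_nonneg_right hy2 hP0
    nlinarith [sq_nonneg ((a - u * c) * x + (b - u * d)), mul_pos hyp hw,
      mul_nonneg (sq_nonneg w) (sq_nonneg (c * x + d))]
  have h2 : P' ≤ (2 + 2 * A ^ 2 / B ^ 2) * Q := by
    have e1 : P' ≤ 2 * Q + 2 * x ^ 2 * P := by
      have i1 : (b - u * d) ^ 2 ≤ 2 * ((a - u * c) * x + (b - u * d)) ^ 2 +
        2 * x ^ 2 * (a - u * c) ^ 2 := by
        nlinarith [sq_nonneg (((a - u * c) * x + (b - u * d)) + (a - u * c) * x)]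
      have i2 : w ^ 2 * d ^ 2 ≤ 2 * (w ^ 2 * (c * x + d) ^ 2) + 2 * x ^ 2 * (w ^ 2 * c ^ 2) := by
        nlinarith [mul_nonneg (sq_nonneg w) (sq_nonneg ((c * x + d) + c * x))]
      have i3 : 0 ≤ y ^ 2 * P := by positivity
      have i4 : 0 ≤ y * w := by positivity
      rw [hP', hQ, hP]
      rw [hP] at i3
      linarith
    have e2 : 2 * x ^ 2 * P ≤ 2 * A ^ 2 * (1 / B ^ 2 * Q) := by
      calc 2 * x ^ 2 * P ≤ 2 * A ^ 2 * P := by gcongr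
        _ ≤ _ := by gcongr
    calc P' ≤ _ := e1
      _ ≤ 2 * Q + 2 * A ^ 2 * (1 / B ^ 2 * Q) := by gcongr
      _ = _ := by ring
  calc a ^ 2 + b ^ 2 + c ^ 2 + d ^ 2 = (a ^ 2 + c ^ 2) + (b ^ 2 + d ^ 2) := by ring
    _ ≤ (2 + (2 * u ^ 2 + 1) / w ^ 2) * P + (2 + (2 * u ^ 2 + 1) / w ^ 2) * P' :=
        add_le_add (sq_add_sq_le_shear u hw a c) (sq_add_sq_le_shear u hw b d)
    _ ≤ (2 + (2 * u ^ 2 + 1) / w ^ 2) * (1 / B ^ 2 * Q) +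
        (2 + (2 * u ^ 2 + 1) / w ^ 2) * ((2 + 2 * A ^ 2 / B ^ 2) * Q) := by gcongr
    _ = _ := by ring

lemma exists_kernelNorm_rpow_le {k : ℝ} (hk : 0 ≤ k) (ξ : ℍ) (A : ℝ) {B : ℝ} (hB : 0 < B) :
    ∃ C : ℝ, 0 ≤ C ∧ ∀ (γ : SL(2, ℤ)), ∀ τ ∈ verticalStrip A B,
      kernelNorm ξ γ τ ^ (-k) ≤ C * entrySq γ ^ (-(k / 2)) := by
  obtain ⟨C, hC, h⟩ := exists_mul_entrySq_le ξ A hB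
  refine ⟨C ^ (-(k / 2)), by positivity, fun γ τ hτ ↦ ?_⟩
  have h1 : kernelNorm ξ γ τ ^ (-k) = (kernelNorm ξ γ τ ^ 2) ^ (-(k / 2)) := by
    rw [← Real.rpow_natCast, ← Real.rpow_mul (kernelNorm_pos ξ γ τ).le]
    congr 1
    push_cast
    ring
  rw [h1, ← Real.mul_rpow hC.le (entrySq_pos γ).le]
  exact Real.rpow_le_rpow_of_nonpos (mul_pos hC (entrySq_pos γ)) (h γ τ hτ) (by linarith)

/-- At the point `i` one has `|c i + d|² = c² + d²` and `|c i + d|² |γ.i|² = a² + b²`. The factor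
`3` comes from replacing the real part by its floor. -/
lemma row_one_sq_mul_le (γ : SL(2, ℤ)) :
    ‖γ 1‖ ^ 2 * (1 + (⌊(γ • UpperHalfPlane.I).re⌋ : ℝ) ^ 2) ≤ 3 * entrySq γ := by
  have hden : ‖denom γ UpperHalfPlane.I‖ ^ 2 = (γ 1 0 : ℝ) ^ 2 + (γ 1 1 : ℝ) ^ 2 := by
    rw [← Complex.normSq_eq_norm_sq, ModularGroup.denom_apply, Complex.normSq_apply]
    simp
    ring
  have hnum : ‖denom γ UpperHalfPlane.I‖ ^ 2 * ‖((γ • UpperHalfPlane.I : ℍ) : ℂ)‖ ^ 2 =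
      (γ 0 0 : ℝ) ^ 2 + (γ 0 1 : ℝ) ^ 2 := by
    rw [← mul_pow, ← norm_mul, denom_mul_coe_smul, ← Complex.normSq_eq_norm_sq,
      Complex.normSq_apply]
    simp
    ring
  have hn : ‖γ 1‖ ^ 2 ≤ ‖denom γ UpperHalfPlane.I‖ ^ 2 := by
    rw [hden, EisensteinSeries.norm_eq_max_natAbs]
    rcases max_choice (γ 1 0).natAbs (γ 1 1).natAbs with h | h <;> rw [h] <;>
      simp only [Nat.cast_natAbs, Int.cast_abs, sq_abs] <;> nlinarith [sq_nonneg (γ 1 0 : ℝ),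
        sq_nonneg (γ 1 1 : ℝ)]
  have hre : (γ • UpperHalfPlane.I).re ^ 2 ≤ ‖((γ • UpperHalfPlane.I : ℍ) : ℂ)‖ ^ 2 := by
    rw [← Complex.normSq_eq_norm_sq, Complex.normSq_apply, ← coe_re]
    nlinarith [sq_nonneg ((γ • UpperHalfPlane.I : ℍ) : ℂ).im]
  have hfl : 1 + (⌊(γ • UpperHalfPlane.I).re⌋ : ℝ) ^ 2 ≤
      3 * (1 + (γ • UpperHalfPlane.I).re ^ 2) := by
    generalize (γ • UpperHalfPlane.I).re = x
    have h1 := Int.floor_le x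
    have h2 := Int.lt_floor_add_one x
    nlinarith [sq_nonneg (x + (x - ⌊x⌋))]
  calc _ ≤ ‖denom γ UpperHalfPlane.I‖ ^ 2 *
        (3 * (1 + ‖((γ • UpperHalfPlane.I : ℍ) : ℂ)‖ ^ 2)) := by
        gcongr
        exact hfl.trans (by gcongr)
    _ = 3 * (‖denom γ UpperHalfPlane.I‖ ^ 2 +
        ‖denom γ UpperHalfPlane.I‖ ^ 2 * ‖((γ • UpperHalfPlane.I : ℍ) : ℂ)‖ ^ 2) := by ring
    _ = _ := by rw [hnum, hden, entrySq]; ring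

/-- Matrices with the same bottom row differ by a power `T ^ m` on the left, which shifts `Re γ.i`
by `m`; the floor detects `m`. -/
lemma row_one_floor_injective :
    Function.Injective fun γ : SL(2, ℤ) ↦ ((γ 1 : Fin 2 → ℤ), ⌊(γ • UpperHalfPlane.I).re⌋) := by
  intro γ δ h
  obtain ⟨h1, h2⟩ := Prod.ext_iff.mp h
  simp only at h1 h2
  obtain ⟨m, hm⟩ : ∃ m : ℤ, δ = T ^ m * γ := by
    refine ⟨δ 0 1 * γ 0 0 - δ 0 0 * γ 0 1, ?_⟩
    have d1 := γ.det_coe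
    have d2 := δ.det_coe
    rw [Matrix.det_fin_two] at d1 d2
    have r0 : δ 1 0 = γ 1 0 := (congrFun h1 0).symm
    have r1 : δ 1 1 = γ 1 1 := (congrFun h1 1).symm
    rw [r0, r1] at d2
    ext i j
    rw [Matrix.SpecialLinearGroup.coe_mul, ModularGroup.coe_T_zpow]
    fin_cases i <;> fin_cases j <;> simp [Matrix.mul_apply, Fin.sum_univ_two, r0, r1]
    · linear_combination (-δ 0 0) * d1 + γ 0 0 * d2
    · linear_combination (-δ 0 1) * d1 + γ 0 1 * d2
  have h3 : (δ • UpperHalfPlane.I).re = (γ • UpperHalfPlane.I).re + m := by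
    rw [hm, SemigroupAction.mul_smul, re_T_zpow_smul]
  rw [h3, Int.floor_add_intCast] at h2
  have : m = 0 := by linarith
  rw [hm, this, zpow_zero, one_mul]

lemma summable_one_add_int_sq_rpow {k : ℝ} (hk : 1 < k) :
    Summable fun n : ℤ ↦ (1 + (n : ℝ) ^ 2) ^ (-(k / 2)) := by
  refine summable_of_isBigO (Real.summable_abs_int_rpow hk) ?_
  refine Asymptotics.IsBigO.of_bound 1 ?_
  -- The index `0` is dropped because `|0| ^ (-k)` has the value `0`, which is no majorant.
  have : {(0 : ℤ)}ᶜ ∈ Filter.cofinite := (Set.finite_singleton 0).compl_mem_cofinite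
  filter_upwards [this] with n hn
  have hn' : (n : ℝ) ≠ 0 := by exact_mod_cast hn
  rw [one_mul, Real.norm_of_nonneg (by positivity), Real.norm_of_nonneg (by positivity)]
  have h2 : |(n : ℝ)| ^ (-k) = ((n : ℝ) ^ 2) ^ (-(k / 2)) := by
    rw [← sq_abs, ← Real.rpow_natCast, ← Real.rpow_mul (abs_nonneg _)]
    congr 1
    push_cast
    ring
  rw [h2]
  exact Real.rpow_le_rpow_of_nonpos (by positivity) (by linarith) (by linarith)

/-- The injection into pairs of a bottom row and an integer bounds the sum by a product of two
series: one over rows, which needs `k > 2`, and one over integers, which needs only `k > 1`. -/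
lemma summable_entrySq_rpow {k : ℝ} (hk : 2 < k) :
    Summable fun γ : SL(2, ℤ) ↦ entrySq γ ^ (-(k / 2)) := by
  have h1 := (EisensteinSeries.summable_one_div_norm_rpow hk).mul_of_nonneg
    (summable_one_add_int_sq_rpow (by linarith : 1 < k)) (fun _ ↦ by positivity)
    (fun _ ↦ by positivity)
  have h2 := (h1.comp_injective row_one_floor_injective).mul_left (3 ^ (k / 2))
  refine h2.of_nonneg_of_le (fun γ ↦ Real.rpow_nonneg (entrySq_pos γ).le _) fun γ ↦ ?_
  have hrow : 0 < ‖γ 1‖ := norm_pos_iff.mpr (γ.row_ne_zero 1)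
  have h3 : ‖γ 1‖ ^ (-k) = (‖γ 1‖ ^ 2) ^ (-(k / 2)) := by
    rw [← Real.rpow_natCast, ← Real.rpow_mul (norm_nonneg _)]
    congr 1
    push_cast
    ring
  simp only [Function.comp]
  rw [h3, ← Real.mul_rpow (by positivity) (by positivity)]
  have h4 := row_one_sq_mul_le γ
  have h5 : (‖γ 1‖ ^ 2 * (1 + (⌊(γ • UpperHalfPlane.I).re⌋ : ℝ) ^ 2)) / 3 ≤ entrySq γ := by
    linarith
  refine (Real.rpow_le_rpow_of_nonpos (by positivity) h5 (by linarith)).trans (le_of_eq ?_)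
  rw [Real.div_rpow (by positivity) (by norm_num), Real.rpow_neg (by norm_num : (0 : ℝ) ≤ 3),
    div_inv_eq_mul, mul_comm]

end Convergence

end VVMF
end

noncomputable section

namespace VVMF

open Filter Topology

/-! ### Fourier expansions and vanishing at infinity. -/

section Fourier

lemma periodic_comp_ofComplex {g : ℍ → ℂ} {N : ℝ} (h : ∀ τ : ℍ, g (N +ᵥ τ) = g τ) :
    Function.Periodic (g ∘ ofComplex) (N : ℂ) := by
  intro w
  by_cases! hw : 0 < w.im
  · have : 0 < (w + (N : ℂ)).im := by simp [hw]
    simp only [Function.comp_apply, ofComplex_apply_of_im_pos this, ofComplex_apply_of_im_pos hw]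
    rw [← h ⟨w, hw⟩]
    congr 1
    ext
    simp [add_comm]
  · have : (w + (N : ℂ)).im ≤ 0 := by simpa using hw
    simp [ofComplex_apply_of_im_nonpos this, ofComplex_apply_of_im_nonpos hw]

lemma qParam_pow_eq (N n : ℕ) (τ : ℍ) :
    Function.Periodic.qParam N τ ^ n = Complex.exp (2 * Real.pi * Complex.I * (n / N) * τ) := by
  rw [Function.Periodic.qParam, ← Complex.exp_nat_mul]
  congr 1
  push_cast
  ring

lemma hasCuspidalFourierExpansion_of_isZeroAtImInfty {g : ℍ → ℂ} {N : ℕ} (hN : 0 < N)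
    (hper : ∀ τ : ℍ, g ((N : ℝ) +ᵥ τ) = g τ) (hg : MDifferentiable 𝓘(ℂ) 𝓘(ℂ) g)
    (h0 : IsZeroAtImInfty g) : HasCuspidalFourierExpansion g := by
  have hN' : (0 : ℝ) < N := by exact_mod_cast hN
  have hper' := periodic_comp_ofComplex hper
  refine ⟨N, hN, fun n ↦ (qExpansion N g).coeff n, ?_, fun τ ↦ ?_⟩
  · beta_reduce
    rw [qExpansion_coeff_zero hN' (analyticAt_cuspFunction_zero hN' hper' hg
      h0.isBoundedAtImInfty) hper']
    exact h0.valueAtInfty_eq_zero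
  · have := hasSum_qExpansion hN' hper' hg h0.isBoundedAtImInfty τ
    simpa only [smul_eq_mul, qParam_pow_eq] using this

/-- As the constant term is zero, `g / q` is again a power series in `q`, hence bounded near
infinity, while `q` tends to `0`. -/
lemma HasCuspidalFourierExpansion.isZeroAtImInfty {g : ℍ → ℂ}
    (hg : HasCuspidalFourierExpansion g) : IsZeroAtImInfty g := by
  obtain ⟨N, hN, a, ha, hs⟩ := hg
  have hN' : (0 : ℝ) < N := by exact_mod_cast hN
  have h1 : ∀ τ : ℍ, HasSum (fun n ↦ a (n + 1) • Function.Periodic.qParam N τ ^ n)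
      (g τ / Function.Periodic.qParam N τ) := fun τ ↦ by
    have hq := Function.Periodic.qParam_ne_zero (h := N) (τ : ℂ)
    have h2 := (hasSum_nat_add_iff' 1).mpr (hs τ)
    simp only [Finset.range_one, Finset.sum_singleton, ha, zero_mul, sub_zero,
      ← qParam_pow_eq] at h2
    have h3 := h2.div_const (Function.Periodic.qParam N τ)
    simp only [pow_succ, ← mul_assoc, mul_div_cancel_right₀ _ hq] at h3
    exact h3
  have h2 := isBoundedAtImInfty_of_hasSum_qExpansion hN' h1
  have h3 := qParam_tendsto_atImInfty hN'
  have h4 := h3.zero_mul_isBoundedUnder_le ((Asymptotics.isBigO_one_iff ℝ).mp h2)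
  refine h4.congr fun τ ↦ mul_div_cancel₀ _ (Function.Periodic.qParam_ne_zero _)

end Fourier

/-! ### Sums of functions with majorants on vertical strips. -/

section Sums

lemma mdifferentiable_tsum {ι : Type*} {g : ι → ℍ → ℂ}
    (hg : ∀ i, MDifferentiable 𝓘(ℂ) 𝓘(ℂ) (g i))
    (hb : ∀ A B : ℝ, 0 < B → ∃ u : ι → ℝ, Summable u ∧
      ∀ i, ∀ τ ∈ verticalStrip A B, ‖g i τ‖ ≤ u i) :
    MDifferentiable 𝓘(ℂ) 𝓘(ℂ) fun τ ↦ ∑' i, g i τ := by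
  intro τ
  rw [mdifferentiableAt_iff]
  obtain ⟨u, hu, hgu⟩ := hb (|τ.re| + 1) (τ.im / 2) (half_pos τ.im_pos)
  set w : Set ℂ := {z | |z.re| < |τ.re| + 1} ∩ {z | τ.im / 2 < z.im}
  have hw : IsOpen w := (isOpen_lt (by fun_prop) (by fun_prop)).inter
    (isOpen_lt (by fun_prop) (by fun_prop))
  have hpos : ∀ z ∈ w, 0 < z.im := fun z hz ↦ (half_pos τ.im_pos).trans hz.2
  have hmem : (τ : ℂ) ∈ w := ⟨by simp, by simpa using half_lt_self τ.im_pos⟩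
  have := Complex.differentiableOn_tsum_of_summable_norm (F := fun i z ↦ (g i ∘ ofComplex) z)
    hu (fun i ↦ ((UpperHalfPlane.mdifferentiable_iff.mp (hg i)).mono hpos)) hw fun i z hz ↦ by
      refine hgu i _ ?_
      rw [ofComplex_apply_of_im_pos (hpos z hz)]
      exact ⟨le_of_lt hz.1, le_of_lt hz.2⟩
  exact this.differentiableAt (hw.mem_nhds hmem)

lemma exists_int_vadd_abs_re_le {N : ℕ} (hN : 0 < N) (τ : ℍ) :
    ∃ m : ℤ, |((m * N : ℝ) +ᵥ τ).re| ≤ N := by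
  have hN' : (0 : ℝ) < N := by exact_mod_cast hN
  refine ⟨-⌊τ.re / N⌋, ?_⟩
  have h1 := Int.floor_le (τ.re / N)
  have h2 := Int.lt_floor_add_one (τ.re / N)
  rw [le_div_iff₀ hN'] at h1
  rw [div_lt_iff₀ hN'] at h2
  rw [vadd_re, abs_le]
  push_cast
  constructor <;> linarith

lemma vadd_int_mul_of_periodic {g : ℍ → ℂ} {N : ℝ} (h : ∀ τ : ℍ, g (N +ᵥ τ) = g τ) (m : ℤ)
    (τ : ℍ) : g ((m * N : ℝ) +ᵥ τ) = g τ := by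
  have := (periodic_comp_ofComplex h).int_mul m (τ : ℂ)
  simp only [Function.comp_apply, ofComplex_apply] at this
  rw [← this]
  congr 1
  have h2 : ((τ : ℂ) + m * N) = (((m * N : ℝ) +ᵥ τ : ℍ) : ℂ) := by
    simp [add_comm]
  rw [h2, ofComplex_apply]

/-- The majorants are uniform on vertical strips only; periodicity moves every point into one strip
without changing its height. -/
lemma isZeroAtImInfty_of_periodic {g : ℍ → ℂ} {N : ℕ} (hN : 0 < N)
    (hper : ∀ τ : ℍ, g ((N : ℝ) +ᵥ τ) = g τ)
    (h : Tendsto g (atImInfty ⊓ 𝓟 (verticalStrip N 1)) (𝓝 0)) : IsZeroAtImInfty g := by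
  rw [isZeroAtImInfty_iff]
  intro ε hε
  have h1 := (Metric.tendsto_nhds.mp h) ε hε
  rw [eventually_inf_principal] at h1
  obtain ⟨A, hA⟩ := (atImInfty_mem _).mp h1
  refine ⟨max A 1, fun z hz ↦ ?_⟩
  obtain ⟨m, hm⟩ := exists_int_vadd_abs_re_le hN z
  rw [← vadd_int_mul_of_periodic hper m z]
  have := hA ((m * N : ℝ) +ᵥ z) (by rw [vadd_im]; exact (le_max_left _ _).trans hz)
    ⟨hm, by rw [vadd_im]; exact (le_max_right _ _).trans hz⟩
  simpa using this.le

end Sums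

/-! ### Periods of the translates of equivariant functions. -/

section Period

variable {p : ℕ} {Γ : Subgroup SL(2, ℤ)} {k : ℝ} {v : SL(2, ℤ) → ℂ}

lemma slash_mulVec (γ : SL(2, ℤ)) (A : Matrix (Fin p) (Fin p) ℂ) (F : ℍ → Fin p → ℂ) (τ : ℍ) :
    slash k v γ (fun τ ↦ A.mulVec (F τ)) τ = A.mulVec (slash k v γ F τ) := by
  simp only [slash, Matrix.mulVec_smul]

/-- If `σ T^M σ⁻¹ ∈ Γ`, translation by `M` acts on `F|σ` through the matrix `v(T)^M ρ(σ T^M σ⁻¹)`,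
which has finite order `N` by normality. The period `N M` is the same for all `F`, so that taking
Fourier coefficients will be linear in `F`. -/
lemma exists_period (hv : IsMultiplierSystem k v) (hfin : Γ.FiniteIndex) {hΓ : -1 ∈ Γ}
    {ρ : Γ →* GL (Fin p) ℂ} (hρ : IsNormal v hΓ ρ) (σ : SL(2, ℤ)) :
    ∃ N : ℕ, 0 < N ∧ ∀ F : ℍ → Fin p → ℂ,
      (∀ (γ : Γ) (τ : ℍ),
        slash k v γ F τ = (ρ γ : Matrix (Fin p) (Fin p) ℂ).mulVec (F τ)) →
      ∀ τ : ℍ, slash k v σ F ((N : ℝ) +ᵥ τ) = slash k v σ F τ := by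
  obtain ⟨M, hM, -, hmem⟩ := Subgroup.exists_pow_mem_of_index_ne_zero hfin.index_ne_zero
    (σ * T * σ⁻¹)
  rw [conj_pow] at hmem
  obtain ⟨N, hN, hone⟩ := hρ.finite_order σ M hM hmem
  set A : Matrix (Fin p) (Fin p) ℂ := (ρ ⟨σ * T ^ M * σ⁻¹, hmem⟩ : Matrix (Fin p) (Fin p) ℂ)
  refine ⟨N * M, Nat.mul_pos hN hM, fun F hF ↦ ?_⟩
  have step : ∀ τ, slash k v σ F ((M : ℝ) +ᵥ τ) = (v T ^ M • A).mulVec (slash k v σ F τ) := by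
    intro τ
    have h1 : slash k v (T ^ M) (slash k v σ F) τ = A.mulVec (slash k v σ F τ) := by
      rw [← slash_mul hv, ← slash_mulVec,
        show σ * T ^ M = (σ * T ^ M * σ⁻¹) * σ by group, slash_mul hv]
      congr 1
      ext1 z
      exact hF ⟨_, hmem⟩ z
    rw [slash, denom_T_pow, T_pow_smul, Complex.one_cpow, mul_one, hv.map_T_pow] at h1
    rw [Matrix.smul_mulVec, ← h1, smul_smul, mul_inv_cancel₀ (pow_ne_zero _ (hv.ne_zero T)),
      one_smul]
  have iter : ∀ (n : ℕ) (τ : ℍ), slash k v σ F (((n * M : ℕ) : ℝ) +ᵥ τ) =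
      ((v T ^ M • A) ^ n).mulVec (slash k v σ F τ) := by
    intro n
    induction n with
    | zero => intro τ; simp
    | succ n ih =>
      intro τ
      have : (((n + 1) * M : ℕ) : ℝ) +ᵥ τ = (M : ℝ) +ᵥ (((n * M : ℕ) : ℝ) +ᵥ τ) := by
        rw [vadd_vadd]
        congr 1
        push_cast
        ring
      rw [this, step, ih, Matrix.mulVec_mulVec, pow_succ']
  intro τ
  rw [iter, hone, Matrix.one_mulVec]

end Period

end VVMF
end

noncomputable section

namespace VVMF

open Filter Topology

/-! ### The series over the whole group is a cusp form. -/

section Poincare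

variable {p : ℕ} {Γ : Subgroup SL(2, ℤ)} {k : ℝ} {v : SL(2, ℤ) → ℂ}

/-- The norm on `Fin p → ℂ` is the sup norm, which unitary matrices do not preserve; bounding the
entries by `1` costs a factor `p`. -/
lemma norm_mulVec_le_of_mem_unitaryGroup {A : Matrix (Fin p) (Fin p) ℂ}
    (hA : A ∈ Matrix.unitaryGroup (Fin p) ℂ) (x : Fin p → ℂ) : ‖A.mulVec x‖ ≤ p * ‖x‖ := by
  refine (pi_norm_le_iff_of_nonneg (by positivity)).mpr fun i ↦ ?_
  calc ‖A.mulVec x i‖ ≤ ∑ j, ‖A i j * x j‖ := by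
        rw [Matrix.mulVec, dotProduct]
        exact norm_sum_le _ _
    _ ≤ ∑ _j : Fin p, ‖x‖ := by
        refine Finset.sum_le_sum fun j _ ↦ ?_
        rw [norm_mul]
        exact (mul_le_mul (entry_norm_bound_of_unitary hA i j) (norm_le_pi_norm x j)
          (norm_nonneg _) zero_le_one).trans_eq (one_mul _)
    _ = p * ‖x‖ := by simp

lemma IsUnitary.inv_mem {ρ : Γ →* GL (Fin p) ℂ} (hρ : IsUnitary ρ) (γ : Γ) :
    (((ρ γ)⁻¹ : GL (Fin p) ℂ) : Matrix (Fin p) (Fin p) ℂ) ∈ Matrix.unitaryGroup (Fin p) ℂ := by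
  rw [← map_inv]
  exact hρ γ⁻¹

lemma ellipticSeed_factor (ν : ℕ) (ξ τ : ℍ) :
    ((τ : ℂ) - ξ) ^ ν / ((τ : ℂ) - (starRingEnd ℂ) ξ) ^ ((ν : ℂ) + k) =
      (((τ : ℂ) - ξ) / ((τ : ℂ) - (starRingEnd ℂ) ξ)) ^ ν *
        ((τ : ℂ) - (starRingEnd ℂ) ξ) ^ (-(k : ℂ)) := by
  rw [Complex.cpow_add _ _ (sub_conj_ne_zero τ ξ), Complex.cpow_natCast, Complex.cpow_neg, div_pow]
  field_simp

lemma norm_sub_le_norm_sub_conj (τ ξ : ℍ) :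
    ‖(τ : ℂ) - ξ‖ ≤ ‖(τ : ℂ) - (starRingEnd ℂ) ξ‖ := by
  refine (sq_le_sq₀ (norm_nonneg _) (norm_nonneg _)).mp ?_
  rw [← Complex.normSq_eq_norm_sq, ← Complex.normSq_eq_norm_sq, Complex.normSq_apply,
    Complex.normSq_apply]
  simp only [Complex.sub_re, Complex.sub_im, Complex.conj_re, Complex.conj_im, coe_re, coe_im]
  nlinarith [mul_pos τ.im_pos ξ.im_pos]

/-- The quotient `(τ - ξ) / (τ - conj ξ)` lies in the unit disc, so the bound does not depend on
`ν`. -/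
lemma norm_ellipticSeed_le (ν : ℕ) (ξ : ℍ) (u : Fin p → ℂ) (τ : ℍ) :
    ‖ellipticSeed k ν ξ u τ‖ ≤ ‖(τ : ℂ) - (starRingEnd ℂ) ξ‖ ^ (-k) * ‖u‖ := by
  rw [ellipticSeed, norm_smul, ellipticSeed_factor, norm_mul, ← Complex.ofReal_neg,
    Complex.norm_cpow_real, norm_pow, norm_div]
  gcongr
  refine mul_le_of_le_one_left (by positivity) (pow_le_one₀ (by positivity) ?_)
  exact div_le_one_of_le₀ (norm_sub_le_norm_sub_conj τ ξ) (norm_nonneg _)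

lemma mdifferentiable_ellipticSeed (ν : ℕ) (ξ : ℍ) (u : Fin p → ℂ) (j : Fin p) :
    MDifferentiable 𝓘(ℂ) 𝓘(ℂ) fun τ ↦ ellipticSeed k ν ξ u τ j := by
  intro τ
  have hs : (τ : ℂ) - (starRingEnd ℂ) ξ ∈ Complex.slitPlane := by
    refine Complex.mem_slitPlane_iff.mpr (Or.inr ?_)
    have : 0 < ((τ : ℂ) - (starRingEnd ℂ) ξ).im := by
      simpa using add_pos τ.im_pos ξ.im_pos
    exact this.ne'
  have h : DifferentiableAt ℂ (fun z : ℂ ↦ ((z - ξ) ^ ν /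
      (z - (starRingEnd ℂ) ξ) ^ ((ν : ℂ) + k)) * u j) τ := by
    refine DifferentiableAt.mul_const (DifferentiableAt.div (by fun_prop) ?_ ?_) _
    · exact DifferentiableAt.cpow_const (by fun_prop) hs
    · rw [Ne, Complex.cpow_eq_zero_iff]
      exact fun h ↦ sub_conj_ne_zero τ ξ h.1
  exact h.mdifferentiableAt.comp τ (mdifferentiable_coe τ)

lemma norm_slash_ellipticSeed_le (hv : IsMultiplierSystem k v) (ν : ℕ) (ξ : ℍ) (u : Fin p → ℂ)
    (γ : SL(2, ℤ)) (τ : ℍ) :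
    ‖slash k v γ (ellipticSeed k ν ξ u) τ‖ ≤ kernelNorm ξ γ τ ^ (-k) * ‖u‖ := by
  rw [norm_slash hv, kernelNorm, Real.mul_rpow (norm_nonneg _) (norm_nonneg _), mul_assoc]
  gcongr
  exact norm_ellipticSeed_le ν ξ u _

lemma slash_slashRep (hv : IsMultiplierSystem k v) (ρ : Γ →* GL (Fin p) ℂ) (σ : SL(2, ℤ)) (γ : Γ)
    (f : ℍ → Fin p → ℂ) (τ : ℍ) :
    slash k v σ (slashRep k v ρ γ f) τ =
      ((ρ γ)⁻¹ : GL (Fin p) ℂ).val.mulVec (slash k v (γ * σ) f τ) := by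
  rw [slash_mul hv]
  exact slash_mulVec σ _ _ τ

lemma norm_slash_slashRep_le (hv : IsMultiplierSystem k v) {ρ : Γ →* GL (Fin p) ℂ}
    (hρ : IsUnitary ρ) (ν : ℕ) (ξ : ℍ) (u : Fin p → ℂ) (σ : SL(2, ℤ)) (γ : Γ) (τ : ℍ) :
    ‖slash k v σ (slashRep k v ρ γ (ellipticSeed k ν ξ u)) τ‖ ≤
      p * ‖u‖ * kernelNorm ξ (γ * σ) τ ^ (-k) := by
  rw [slash_slashRep hv]
  refine (norm_mulVec_le_of_mem_unitaryGroup (hρ.inv_mem γ) _).trans ?_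
  rw [mul_assoc, mul_comm ‖u‖]
  gcongr
  exact norm_slash_ellipticSeed_le hv ν ξ u _ τ

lemma slash_one (hv : IsMultiplierSystem k v) {E : Type*} [MulAction ℂ E] (F : ℍ → E) :
    slash k v 1 F = F := by
  ext1 τ
  have h1 : v 1 = 1 := hv.map_T_pow 0
  have h2 : denom (1 : SL(2, ℤ)) τ = 1 := by simp
  rw [slash, h1, h2]
  simp

/-- A summable majorant of the translates of the terms of an elliptic Poincaré series, uniform on
vertical strips. -/
lemma exists_summable_bound (hk : 2 < k) (hv : IsMultiplierSystem k v) {ρ : Γ →* GL (Fin p) ℂ}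
    (hρ : IsUnitary ρ) (ν : ℕ) (ξ : ℍ) (u : Fin p → ℂ) (σ : SL(2, ℤ)) (A B : ℝ) (hB : 0 < B) :
    ∃ M : Γ → ℝ, Summable M ∧ ∀ γ, ∀ τ ∈ verticalStrip A B,
      ‖slash k v σ (slashRep k v ρ γ (ellipticSeed k ν ξ u)) τ‖ ≤ M γ := by
  obtain ⟨C, hC, h⟩ := exists_kernelNorm_rpow_le (by linarith : 0 ≤ k) ξ A hB
  refine ⟨fun γ ↦ p * ‖u‖ * (C * entrySq (γ * σ) ^ (-(k / 2))), ?_, fun γ τ hτ ↦ ?_⟩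
  · have hinj : Function.Injective fun γ : Γ ↦ (γ : SL(2, ℤ)) * σ :=
      fun a b hab ↦ Subtype.ext (mul_right_cancel hab)
    exact (((summable_entrySq_rpow hk).comp_injective hinj).mul_left C).mul_left _
  · refine (norm_slash_slashRep_le hv hρ ν ξ u σ γ τ).trans ?_
    exact mul_le_mul_of_nonneg_left (h _ τ hτ) (by positivity)

lemma summable_norm_slash_slashRep (hk : 2 < k) (hv : IsMultiplierSystem k v)
    {ρ : Γ →* GL (Fin p) ℂ} (hρ : IsUnitary ρ) (ν : ℕ) (ξ : ℍ) (u : Fin p → ℂ) (σ : SL(2, ℤ))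
    (τ : ℍ) :
    Summable fun γ : Γ ↦ ‖slash k v σ (slashRep k v ρ γ (ellipticSeed k ν ξ u)) τ‖ := by
  obtain ⟨M, hM, h⟩ := exists_summable_bound hk hv hρ ν ξ u σ |τ.re| τ.im τ.im_pos
  exact hM.of_nonneg_of_le (fun _ ↦ norm_nonneg _) fun γ ↦ h γ τ ⟨le_rfl, le_rfl⟩

lemma summable_norm_slashRep (hk : 2 < k) (hv : IsMultiplierSystem k v)
    {ρ : Γ →* GL (Fin p) ℂ} (hρ : IsUnitary ρ) (ν : ℕ) (ξ : ℍ) (u : Fin p → ℂ) (τ : ℍ) :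
    Summable fun γ : Γ ↦ ‖slashRep k v ρ γ (ellipticSeed k ν ξ u) τ‖ := by
  simpa only [slash_one hv] using summable_norm_slash_slashRep hk hv hρ ν ξ u 1 τ

/-- The sum of all translates of the seed, a multiple of the elliptic Poincaré series. -/
def groupSeries (k : ℝ) (v : SL(2, ℤ) → ℂ) (ρ : Γ →* GL (Fin p) ℂ) (ν : ℕ) (ξ : ℍ)
    (u : Fin p → ℂ) : ℍ → Fin p → ℂ :=
  fun τ ↦ ∑' γ : Γ, slashRep k v ρ γ (ellipticSeed k ν ξ u) τ

lemma tsum_mulVec {ι : Type*} (A : Matrix (Fin p) (Fin p) ℂ) {g : ι → Fin p → ℂ}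
    (hg : Summable g) : ∑' i, A.mulVec (g i) = A.mulVec (∑' i, g i) :=
  ((Matrix.mulVecLin A).toContinuousLinearMap.map_tsum hg).symm

lemma slash_groupSeries (σ : SL(2, ℤ)) (ρ : Γ →* GL (Fin p) ℂ) (ν : ℕ) (ξ : ℍ)
    (u : Fin p → ℂ) (τ : ℍ) :
    slash k v σ (groupSeries k v ρ ν ξ u) τ =
      ∑' γ : Γ, slash k v σ (slashRep k v ρ γ (ellipticSeed k ν ξ u)) τ :=
  (tsum_const_smul'' _).symm

/-- Because the sum runs over `Γ` and not over cosets, acting by `γ` merely permutes the terms by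
right multiplication. -/
lemma slash_groupSeries_of_mem (hk : 2 < k) (hv : IsMultiplierSystem k v) {ρ : Γ →* GL (Fin p) ℂ}
    (hρ : IsUnitary ρ) (ν : ℕ) (ξ : ℍ) (u : Fin p → ℂ) (γ : Γ) (τ : ℍ) :
    slash k v γ (groupSeries k v ρ ν ξ u) τ =
      (ρ γ : Matrix (Fin p) (Fin p) ℂ).mulVec (groupSeries k v ρ ν ξ u τ) := by
  have h1 : groupSeries k v ρ ν ξ u τ = ((ρ γ)⁻¹ : GL (Fin p) ℂ).val.mulVec
      (slash k v γ (groupSeries k v ρ ν ξ u) τ) := by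
    rw [slash_groupSeries,
      ← tsum_mulVec _ (summable_norm_slash_slashRep hk hv hρ ν ξ u γ τ).of_norm,
      groupSeries, ← (Equiv.mulRight γ).tsum_eq]
    refine tsum_congr fun δ ↦ ?_
    rw [Equiv.coe_mulRight, slashRep_mul hv]
    rfl
  rw [h1, Matrix.mulVec_mulVec]
  simp

/-- All other terms in `kernelNorm_sq` being nonnegative, the squared kernel is at least `2 Im τ Im
ξ`. -/
lemma tendsto_kernelNorm_rpow (hk : 0 < k) (ξ : ℍ) (γ : SL(2, ℤ)) :
    Tendsto (fun τ ↦ kernelNorm ξ γ τ ^ (-k)) atImInfty (𝓝 0) := by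
  have h1 : Tendsto (fun τ ↦ kernelNorm ξ γ τ) atImInfty atTop := by
    have h2 : Tendsto (fun τ : ℍ ↦ √(2 * τ.im * ξ.im)) atImInfty atTop := by
      have h3 : Tendsto (fun τ : ℍ ↦ 2 * τ.im * ξ.im) atImInfty atTop :=
        (tendsto_comap.const_mul_atTop two_pos).atTop_mul_const ξ.im_pos
      exact Real.tendsto_sqrt_atTop.comp h3
    refine tendsto_atTop_mono (fun τ ↦ ?_) h2
    refine Real.sqrt_le_iff.mpr ⟨(kernelNorm_pos ξ γ τ).le, ?_⟩
    rw [kernelNorm_sq]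
    have : 0 ≤ ((γ 0 0 - ξ.re * γ 1 0) * τ.re + (γ 0 1 - ξ.re * γ 1 1)) ^ 2 +
        ξ.im ^ 2 * (γ 1 0 * τ.re + γ 1 1) ^ 2 +
        τ.im ^ 2 * ((γ 0 0 - ξ.re * γ 1 0) ^ 2 + ξ.im ^ 2 * γ 1 0 ^ 2) := by positivity
    linarith
  exact (tendsto_rpow_neg_atTop hk).comp h1

lemma groupSeries_mem_cuspForms (hk : 2 < k) (hv : IsMultiplierSystem k v) (hfin : Γ.FiniteIndex)
    {hΓ : -1 ∈ Γ} {ρ : Γ →* GL (Fin p) ℂ} (hρ : IsUnitary ρ) (hnormal : IsNormal v hΓ ρ) (ν : ℕ)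
    (ξ : ℍ) (u : Fin p → ℂ) : groupSeries k v ρ ν ξ u ∈ cuspForms k v ρ := by
  have heq := slash_groupSeries_of_mem hk hv hρ ν ξ u
  have hcomp : ∀ (σ : SL(2, ℤ)) (τ : ℍ) (j : Fin p),
      slash k v σ (fun τ ↦ groupSeries k v ρ ν ξ u τ j) τ =
        ∑' γ : Γ, slash k v σ (slashRep k v ρ γ (ellipticSeed k ν ξ u)) τ j := fun σ τ j ↦ by
    rw [← slash_apply_comp, slash_groupSeries]
    exact tsum_apply (summable_norm_slash_slashRep hk hv hρ ν ξ u σ τ).of_norm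
  have hterm : ∀ (σ : SL(2, ℤ)) (γ : Γ) (τ : ℍ) (j : Fin p),
      ‖slash k v σ (slashRep k v ρ γ (ellipticSeed k ν ξ u)) τ j‖ ≤
        ‖slash k v σ (slashRep k v ρ γ (ellipticSeed k ν ξ u)) τ‖ := fun σ γ τ j ↦
    norm_le_pi_norm _ j
  have hmdiff : ∀ (γ : Γ) (j : Fin p), MDifferentiable 𝓘(ℂ) 𝓘(ℂ)
      fun τ ↦ slashRep k v ρ γ (ellipticSeed k ν ξ u) τ j := fun γ j ↦ by
    have : (fun τ ↦ slashRep k v ρ γ (ellipticSeed k ν ξ u) τ j) =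
        ∑ i, fun τ ↦ ((ρ γ)⁻¹ : GL (Fin p) ℂ).val j i *
          slash k v γ (fun τ ↦ ellipticSeed k ν ξ u τ i) τ := by
      ext τ
      rw [Finset.sum_apply]
      rfl
    rw [this]
    exact MDifferentiable.sum fun i _ ↦
      (mdifferentiable_slash (mdifferentiable_ellipticSeed ν ξ u i) γ).const_smul _
  have hmd : ∀ j, MDifferentiable 𝓘(ℂ) 𝓘(ℂ) fun τ ↦ groupSeries k v ρ ν ξ u τ j := fun j ↦ by
    have h1 : (fun τ ↦ groupSeries k v ρ ν ξ u τ j) =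
        fun τ ↦ ∑' γ : Γ, slashRep k v ρ γ (ellipticSeed k ν ξ u) τ j := by
      ext τ
      exact tsum_apply (summable_norm_slashRep hk hv hρ ν ξ u τ).of_norm
    rw [h1]
    refine mdifferentiable_tsum (fun γ ↦ hmdiff γ j) fun A B hB ↦ ?_
    obtain ⟨M, hM, h⟩ := exists_summable_bound hk hv hρ ν ξ u 1 A B hB
    refine ⟨M, hM, fun γ τ hτ ↦ ?_⟩
    have := (hterm 1 γ τ j).trans (h γ τ hτ)
    rwa [slash_one hv] at this
  refine ⟨fun j ↦ ⟨hmd j, fun σ ↦ ?_⟩, heq⟩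
  obtain ⟨N, hN, hper⟩ := exists_period hv hfin hnormal σ
  have hper' : ∀ τ : ℍ, slash k v σ (fun τ ↦ groupSeries k v ρ ν ξ u τ j) ((N : ℝ) +ᵥ τ) =
      slash k v σ (fun τ ↦ groupSeries k v ρ ν ξ u τ j) τ := fun τ ↦
    congrFun (hper _ heq τ) j
  refine hasCuspidalFourierExpansion_of_isZeroAtImInfty hN hper' (mdifferentiable_slash (hmd j) σ)
    (isZeroAtImInfty_of_periodic hN hper' ?_)
  obtain ⟨M, hM, h⟩ := exists_summable_bound hk hv hρ ν ξ u σ N 1 one_pos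
  -- Inside a strip as wide as the period, the series tends to `0` term by term under a summable
  -- majorant.
  have hlim := tendsto_tsum_of_dominated_convergence (𝓕 := atImInfty ⊓ 𝓟 (verticalStrip N 1))
    (f := fun τ (γ : Γ) ↦ slash k v σ (slashRep k v ρ γ (ellipticSeed k ν ξ u)) τ j)
    (g := fun _ ↦ 0) hM (fun γ ↦ ?_) ?_
  · rw [tsum_zero] at hlim
    exact hlim.congr fun τ ↦ (hcomp σ τ j).symm
  · refine Tendsto.mono_left ?_ inf_le_left
    have h2 := (tendsto_kernelNorm_rpow (by linarith : 0 < k) ξ (γ * σ)).const_mul (p * ‖u‖)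
    rw [mul_zero] at h2
    exact squeeze_zero_norm (fun τ ↦ (hterm σ γ τ j).trans
      (norm_slash_slashRep_le hv hρ ν ξ u σ γ τ)) h2
  · rw [eventually_inf_principal]
    exact Eventually.of_forall fun τ hτ γ ↦ (hterm σ γ τ j).trans (h γ τ hτ)

end Poincare

/-! ### Decomposition of a group into right cosets. -/

section Cosets

variable {G : Type*} [Group G]

/-- Every element of `G` is uniquely a product of an element of `Λ` and a representative of a right
coset. -/
def subgroupProdQuotientEquiv (Λ : Subgroup G) :
    Quotient (QuotientGroup.rightRel Λ) × Λ ≃ G :=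
  Equiv.ofBijective (fun x ↦ x.2 * x.1.out) <| by
    constructor
    · rintro ⟨c, l⟩ ⟨c', l'⟩ h
      have hc : c = c' := by
        rw [← c.out_eq, ← c'.out_eq]
        refine Quotient.sound (QuotientGroup.rightRel_apply.mpr ?_)
        have : c'.out * c.out⁻¹ = (l' : G)⁻¹ * l := by
          simp only at h
          rw [eq_inv_mul_iff_mul_eq, ← mul_assoc, ← h]
          group
        rw [this]
        exact Λ.mul_mem (Λ.inv_mem l'.2) l.2
      subst hc
      exact Prod.ext rfl (Subtype.ext (mul_right_cancel h))
    · intro γ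
      have h := QuotientGroup.rightRel_apply.mp
        (Quotient.mk_out (s := QuotientGroup.rightRel Λ) γ)
      exact ⟨(Quotient.mk _ γ, ⟨_, h⟩), by simp⟩

lemma subgroupProdQuotientEquiv_apply (Λ : Subgroup G)
    (x : Quotient (QuotientGroup.rightRel Λ) × Λ) :
    subgroupProdQuotientEquiv Λ x = x.2 * x.1.out := rfl

end Cosets

/-! ### From sums over `Γ` to sums over `⟨-I⟩\Γ`. -/

section Poincare

variable {p : ℕ} {Γ : Subgroup SL(2, ℤ)} {k : ℝ} {v : SL(2, ℤ) → ℂ}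

lemma finite_zpowers_neg_one (hΓ : -1 ∈ Γ) :
    Finite (Subgroup.zpowers (⟨-1, hΓ⟩ : Γ)) := by
  refine (finite_zpowers.mpr (isOfFinOrder_iff_pow_eq_one.mpr ?_)).to_subtype
  exact ⟨2, two_pos, by ext1; simp⟩

/-- Each coset contributes the same term once for every element of `⟨-I⟩`. Only finiteness of this
subgroup matters, not its exact order. -/
lemma groupSeries_eq_smul (hk : 2 < k) (hv : IsMultiplierSystem k v) {hΓ : -1 ∈ Γ}
    {ρ : Γ →* GL (Fin p) ℂ} (hρ : IsUnitary ρ) (hnormal : IsNormal v hΓ ρ) (ν : ℕ) (ξ : ℍ)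
    (u : Fin p → ℂ) : groupSeries k v ρ ν ξ u =
      (Nat.card (Subgroup.zpowers (⟨-1, hΓ⟩ : Γ)) : ℂ) • ellipticPoincare k v hΓ ρ ν ξ u := by
  have := finite_zpowers_neg_one hΓ
  have := Fintype.ofFinite (Subgroup.zpowers (⟨-1, hΓ⟩ : Γ))
  ext1 τ
  have hs := (summable_norm_slashRep hk hv hρ ν ξ u τ).of_norm
  have hs' := (Equiv.summable_iff
    (subgroupProdQuotientEquiv (Subgroup.zpowers (⟨-1, hΓ⟩ : Γ)))).mpr hs
  simp only [Function.comp_def] at hs'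
  rw [groupSeries, ← (subgroupProdQuotientEquiv (Subgroup.zpowers (⟨-1, hΓ⟩ : Γ))).tsum_eq,
    hs'.tsum_prod, Pi.smul_apply, ellipticPoincare,
    poincareSeries, ← tsum_const_smul'']
  refine tsum_congr fun c ↦ ?_
  have : ∀ l : Subgroup.zpowers (⟨-1, hΓ⟩ : Γ), slashRep k v ρ
      (subgroupProdQuotientEquiv (Subgroup.zpowers (⟨-1, hΓ⟩ : Γ)) (c, l))
        (ellipticSeed k ν ξ u) τ = slashRep k v ρ c.out (ellipticSeed k ν ξ u) τ := fun l ↦ by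
    rw [subgroupProdQuotientEquiv_apply, slashRep_mul hv,
      slashRep_eq_self_of_mem_zpowers hv hΓ ρ hnormal.neg_one _ _ l.2]
  simp only [this, tsum_fintype, Finset.sum_const, Finset.card_univ, Nat.card_eq_fintype_card,
    Nat.cast_smul_eq_nsmul]

lemma ellipticPoincare_mem_cuspForms (hk : 2 < k) (hv : IsMultiplierSystem k v)
    (hfin : Γ.FiniteIndex) {hΓ : -1 ∈ Γ} {ρ : Γ →* GL (Fin p) ℂ} (hρ : IsUnitary ρ)
    (hnormal : IsNormal v hΓ ρ) (ν : ℕ) (ξ : ℍ) (u : Fin p → ℂ) :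
    ellipticPoincare k v hΓ ρ ν ξ u ∈ cuspForms k v ρ := by
  have := finite_zpowers_neg_one hΓ
  have h := groupSeries_mem_cuspForms hk hv hfin hρ hnormal ν ξ u
  rw [groupSeries_eq_smul hk hv hρ hnormal] at h
  exact (Submodule.smul_mem_iff _ (Nat.cast_ne_zero.mpr Nat.card_pos.ne')).mp h

end Poincare

end VVMF
end

noncomputable section

namespace VVMF

open Filter Topology

/-! ### Decay at infinity from vanishing Fourier coefficients. -/

section Decay

/-- This is the Schwarz lemma for the function of `q` on the disc of radius `exp(-2π y₀ / N)`: it is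
bounded by `B` and vanishes at `0` to order at least `m + 1`. -/
lemma norm_le_of_qExpansion_coeff_eq_zero {g : ℍ → ℂ} {N : ℝ} (hN : 0 < N)
    (hper : ∀ τ : ℍ, g (N +ᵥ τ) = g τ) (hg : MDifferentiable 𝓘(ℂ) 𝓘(ℂ) g)
    (h0 : IsZeroAtImInfty g) {m : ℕ} (hm : ∀ i < m + 1, (qExpansion N g).coeff i = 0)
    {y₀ B : ℝ} (hy₀ : 0 ≤ y₀) (hB : ∀ τ : ℍ, y₀ < τ.im → ‖g τ‖ ≤ B) {τ : ℍ} (hτ : y₀ < τ.im) :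
    ‖g τ‖ ≤ B * Real.exp (-2 * Real.pi * (τ.im - y₀) / N) ^ (m + 1) := by
  have hper' := periodic_comp_ofComplex hper
  have hbd := h0.isBoundedAtImInfty
  have hB0 : 0 ≤ B := (norm_nonneg _).trans (hB τ hτ)
  set f := cuspFunction N g with hf
  set r := Real.exp (-2 * Real.pi * y₀ / N) with hr
  have hr1 : r ≤ 1 := by
    rw [hr, Real.exp_le_one_iff]
    have : 0 ≤ 2 * Real.pi * y₀ / N := by positivity
    have e : -2 * Real.pi * y₀ / N = -(2 * Real.pi * y₀ / N) := by ring
    linarith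
  have hd : DifferentiableOn ℂ f (Metric.ball 0 r) :=
    (differentiableOn_cuspFunction_ball hN hper' hg hbd).mono (Metric.ball_subset_ball hr1)
  have hf0 : f 0 = 0 := h0.cuspFunction_apply_zero hN
  have han : AnalyticAt ℂ f 0 := analyticAt_cuspFunction_zero hN hper' hg hbd
  have hmaps : Set.MapsTo f (Metric.ball 0 r) (Metric.closedBall (f 0) B) := by
    intro q hq
    rw [hf0, mem_closedBall_zero_iff]
    rcases eq_or_ne q 0 with rfl | hq0
    · rwa [hf0, norm_zero]
    · have hq' : ‖q‖ < r := by simpa using hq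
      have him := Function.Periodic.im_invQParam_pos_of_norm_lt_one hN (hq'.trans_le hr1) hq0
      have e1 : Function.Periodic.qParam N (Function.Periodic.invQParam N q) = q :=
        Function.Periodic.qParam_right_inv hN.ne' hq0
      have e2 : f q = g ⟨_, him⟩ := by
        rw [← eq_cuspFunction ⟨_, him⟩ hN.ne' hper', ← hf]
        exact congrArg f e1.symm
      rw [e2]
      refine hB _ ?_
      have e3 : (⟨_, him⟩ : ℍ).im = (Function.Periodic.invQParam N q).im := rfl
      rw [e3, ← Function.Periodic.norm_qParam_lt_iff hN, e1]
      exact hq'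
  -- The Schwarz lemma takes the vanishing as `o(|w|^m)` and returns the exponent `m + 1`.
  have ho : (f · - f 0) =o[𝓝 0] fun w ↦ ‖w - 0‖ ^ m := by
    simp only [hf0, sub_zero]
    have hord : ((m + 1 : ℕ) : ℕ∞) ≤ analyticOrderAt f 0 := by
      rw [natCast_le_analyticOrderAt_iff_iteratedDeriv_eq_zero han]
      intro i hi
      have := hm i hi
      rw [qExpansion_coeff] at this
      simpa [Nat.factorial_ne_zero] using this
    obtain ⟨G, hG, hfG⟩ := (natCast_le_analyticOrderAt han).mp hord
    have h1 : (fun w : ℂ ↦ w * G w) =o[𝓝 0] fun _ ↦ (1 : ℝ) := by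
      rw [Asymptotics.isLittleO_one_iff]
      have := (continuousAt_id (x := (0 : ℂ))).mul hG.continuousAt
      simpa [ContinuousAt, Pi.mul_def] using this
    have h2 : (fun w : ℂ ↦ w ^ m) =O[𝓝 0] fun w ↦ ‖w‖ ^ m :=
      Asymptotics.IsBigO.of_bound 1 (by simp)
    have h3 := h2.mul_isLittleO h1
    simp only [mul_one] at h3
    refine h3.congr' ?_ EventuallyEq.rfl
    filter_upwards [hfG] with w hw
    rw [hw, sub_zero, smul_eq_mul, pow_succ]
    ring
  have hq : Function.Periodic.qParam N τ ∈ Metric.ball (0 : ℂ) r := by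
    rw [mem_ball_zero_iff]
    exact (Function.Periodic.norm_qParam_lt_iff hN y₀ τ).mpr hτ
  have key := Complex.dist_le_mul_div_pow_of_mapsTo_ball_of_isLittleO hd hmaps ho hq
  rw [hf0, dist_zero_right, dist_zero_right, hf, eq_cuspFunction τ hN.ne' hper',
    Function.Periodic.norm_qParam, hr, ← Real.exp_sub] at key
  convert key using 4
  rw [coe_im]
  ring

/-- The half-plane above `y₀` maps into a compact disc inside the unit disc, on which the function
of `q` is continuous. -/
lemma exists_norm_le_of_isZeroAtImInfty {g : ℍ → ℂ} {N : ℝ} (hN : 0 < N)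
    (hper : ∀ τ : ℍ, g (N +ᵥ τ) = g τ) (hg : MDifferentiable 𝓘(ℂ) 𝓘(ℂ) g)
    (h0 : IsZeroAtImInfty g) {y₀ : ℝ} (hy₀ : 0 < y₀) :
    ∃ B : ℝ, ∀ τ : ℍ, y₀ < τ.im → ‖g τ‖ ≤ B := by
  have hper' := periodic_comp_ofComplex hper
  set r := Real.exp (-2 * Real.pi * y₀ / N) with hr
  have hr1 : r < 1 := by
    rw [hr, Real.exp_lt_one_iff]
    have : 0 < 2 * Real.pi * y₀ / N := by positivity
    have e : -2 * Real.pi * y₀ / N = -(2 * Real.pi * y₀ / N) := by ring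
    linarith
  have hc : ContinuousOn (cuspFunction N g) (Metric.closedBall 0 r) :=
    (differentiableOn_cuspFunction_ball hN hper' hg h0.isBoundedAtImInfty).continuousOn.mono
      (Metric.closedBall_subset_ball hr1)
  obtain ⟨B, hB⟩ := (isCompact_closedBall (0 : ℂ) r).exists_bound_of_continuousOn hc
  refine ⟨B, fun τ hτ ↦ ?_⟩
  rw [← eq_cuspFunction τ hN.ne' hper']
  refine hB _ ?_
  rw [mem_closedBall_zero_iff]
  exact ((Function.Periodic.norm_qParam_lt_iff hN y₀ τ).mpr hτ).le

lemma exists_rpow_mul_exp_neg_le {s b : ℝ} (hs : 0 < s) (hb : 0 < b) :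
    ∃ C : ℝ, 0 < C ∧ ∀ y : ℝ, 0 ≤ y → y ^ s * Real.exp (-(b * y)) ≤ C := by
  -- The constant comes from `t ≤ exp t` at `t = b y / s`, raised to the power `s`.
  refine ⟨(s / b) ^ s, by positivity, fun y hy ↦ ?_⟩
  rw [Real.exp_neg, ← div_eq_mul_inv, div_le_iff₀ (Real.exp_pos _)]
  have h1 : y = s / b * (b * y / s) := by field_simp
  have h2 : (b * y / s) ^ s ≤ Real.exp (b * y) := by
    have h3 : b * y / s ≤ Real.exp (b * y / s) := by linarith [Real.add_one_le_exp (b * y / s)]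
    calc (b * y / s) ^ s ≤ Real.exp (b * y / s) ^ s := by gcongr
      _ = _ := by rw [← Real.exp_mul]; congr 1; field_simp
  calc y ^ s = (s / b) ^ s * (b * y / s) ^ s := by
        rw [← Real.mul_rpow (by positivity) (by positivity), ← h1]
    _ ≤ _ := by gcongr

/-- For `y ≥ 2 y₀` both `y - y₀ ≥ y₀` and `y - y₀ ≥ y / 2`. One exponential factor absorbs `y ^ s`;
the other `m` make the product small uniformly in `y`. -/
lemma exists_pow_decay_le {s c y₀ ε : ℝ} (hs : 0 < s) (hc : 0 < c) (hy₀ : 0 < y₀) (hε : 0 < ε) :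
    ∃ m : ℕ, ∀ y : ℝ, 2 * y₀ ≤ y →
      y ^ s * y₀ ^ (-s) * Real.exp (-(c * (y - y₀))) ^ (m + 1) ≤ ε := by
  obtain ⟨C, hC, h⟩ := exists_rpow_mul_exp_neg_le hs (half_pos hc)
  have hlim : Tendsto (fun m : ℕ ↦ C * y₀ ^ (-s) * Real.exp (-(c * y₀)) ^ m) atTop (𝓝 0) := by
    have := (tendsto_pow_atTop_nhds_zero_of_lt_one (Real.exp_pos (-(c * y₀))).le
      (by rw [Real.exp_lt_one_iff]; nlinarith [mul_pos hc hy₀])).const_mul (C * y₀ ^ (-s))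
    simpa using this
  obtain ⟨m, hm⟩ := (hlim.eventually (gt_mem_nhds hε)).exists
  refine ⟨m, fun y hy ↦ le_trans ?_ hm.le⟩
  have e1 : Real.exp (-(c * (y - y₀))) ≤ Real.exp (-(c * y₀)) := by
    apply Real.exp_le_exp.mpr
    nlinarith
  have e2 : Real.exp (-(c * (y - y₀))) ≤ Real.exp (-(c / 2 * y)) := by
    apply Real.exp_le_exp.mpr
    nlinarith
  calc y ^ s * y₀ ^ (-s) * Real.exp (-(c * (y - y₀))) ^ (m + 1)
      = y ^ s * y₀ ^ (-s) * (Real.exp (-(c * (y - y₀))) ^ m * Real.exp (-(c * (y - y₀)))) := by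
        rw [pow_succ]
    _ ≤ y ^ s * y₀ ^ (-s) * (Real.exp (-(c * y₀)) ^ m * Real.exp (-(c / 2 * y))) := by
        have : 0 ≤ y := by linarith
        gcongr
    _ = (y ^ s * Real.exp (-(c / 2 * y))) * y₀ ^ (-s) * Real.exp (-(c * y₀)) ^ m := by ring
    _ ≤ _ := by
        gcongr
        exact h y (by linarith)

end Decay

/-! ### Boundedness of cusp forms, Sturm bound and finite dimension. -/

section Finite

variable {p : ℕ} {Γ : Subgroup SL(2, ℤ)} {k : ℝ} {v : SL(2, ℤ) → ℂ}

lemma exists_mul_inv_out (Γ : Subgroup SL(2, ℤ)) (g : SL(2, ℤ)) :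
    ∃ (γ : Γ) (c : SL(2, ℤ) ⧸ Γ), g = γ * c.out⁻¹ := by
  obtain ⟨h, hh⟩ := QuotientGroup.mk_out_eq_mul Γ g⁻¹
  refine ⟨h, (g⁻¹ : SL(2, ℤ)), ?_⟩
  rw [hh]
  group

/-- Bounds for an equivariant function follow from bounds for finitely many translates on the
standard fundamental domain. -/
lemma norm_mul_im_rpow_le (hv : IsMultiplierSystem k v) {ρ : Γ →* GL (Fin p) ℂ}
    (hρ : IsUnitary ρ) {F : ℍ → Fin p → ℂ}
    (hF : ∀ (γ : Γ) (τ : ℍ),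
      slash k v γ F τ = (ρ γ : Matrix (Fin p) (Fin p) ℂ).mulVec (F τ)) {D : ℝ}
    (hD : ∀ (c : SL(2, ℤ) ⧸ Γ) (τ : ℍ), 4 / 5 < τ.im →
      ‖slash k v c.out⁻¹ F τ‖ * τ.im ^ (k / 2) ≤ D) (τ : ℍ) :
    ‖F τ‖ * τ.im ^ (k / 2) ≤ p * D := by
  obtain ⟨g, hg⟩ := ModularGroup.exists_smul_mem_fd τ
  obtain ⟨γ, c, h⟩ := exists_mul_inv_out Γ g⁻¹
  -- On the standard domain the height is at least `√3 / 2 > 4 / 5`.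
  have him : 4 / 5 < (g • τ).im := by
    have := ModularGroup.three_le_four_mul_im_sq_of_mem_fd hg
    nlinarith [(g • τ).im_pos]
  have e1 := norm_slash_mul_im_rpow hv g⁻¹ F (g • τ)
  rw [inv_smul_smul] at e1
  have e2 : slash k v g⁻¹ F (g • τ) =
      (ρ γ : Matrix (Fin p) (Fin p) ℂ).mulVec (slash k v c.out⁻¹ F (g • τ)) := by
    rw [h, slash_mul hv, ← slash_mulVec]
    congr 1
    ext1 z
    exact hF γ z
  rw [← e1, e2]
  have e3 := norm_mulVec_le_of_mem_unitaryGroup (hρ γ) (slash k v c.out⁻¹ F (g • τ))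
  have e4 := hD c (g • τ) him
  calc _ ≤ p * ‖slash k v c.out⁻¹ F (g • τ)‖ * (g • τ).im ^ (k / 2) := by
        gcongr
    _ = p * (‖slash k v c.out⁻¹ F (g • τ)‖ * (g • τ).im ^ (k / 2)) := by ring
    _ ≤ _ := by gcongr

lemma exists_common_period (hv : IsMultiplierSystem k v) (hfin : Γ.FiniteIndex) {hΓ : -1 ∈ Γ}
    {ρ : Γ →* GL (Fin p) ℂ} (hρ : IsNormal v hΓ ρ) :
    ∃ N : (SL(2, ℤ) ⧸ Γ) → ℕ, ∀ c, 0 < N c ∧ ∀ F ∈ cuspForms k v ρ, ∀ (τ : ℍ) (j : Fin p),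
      slash k v c.out⁻¹ (fun τ ↦ F τ j) ((N c : ℝ) +ᵥ τ) =
        slash k v c.out⁻¹ (fun τ ↦ F τ j) τ := by
  choose N hN hper using fun c : SL(2, ℤ) ⧸ Γ ↦ exists_period hv hfin hρ c.out⁻¹
  exact ⟨N, fun c ↦ ⟨hN c, fun F hF τ j ↦ congrFun (hper c F hF.2 τ) j⟩⟩

lemma norm_slash_le_of_comp {σ : SL(2, ℤ)} {F : ℍ → Fin p → ℂ} {τ : ℍ} {D : ℝ} (hD : 0 ≤ D)
    (h : ∀ j, ‖slash k v σ (fun τ ↦ F τ j) τ‖ * τ.im ^ (k / 2) ≤ D) :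
    ‖slash k v σ F τ‖ * τ.im ^ (k / 2) ≤ D := by
  have hpos : 0 < τ.im ^ (k / 2) := Real.rpow_pos_of_pos τ.im_pos _
  rw [← le_div_iff₀ hpos, pi_norm_le_iff_of_nonneg (by positivity)]
  intro j
  rw [le_div_iff₀ hpos]
  exact h j

/-- The vanishing constant term alone gives exponential decay above height `4 / 5`, which beats
`y^(k/2)`; finitely many cosets and components remain. -/
lemma exists_bound_of_mem_cuspForms (hk : 2 < k) (hv : IsMultiplierSystem k v)
    (hfin : Γ.FiniteIndex) {hΓ : -1 ∈ Γ} {ρ : Γ →* GL (Fin p) ℂ} (hρ : IsUnitary ρ)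
    (hnormal : IsNormal v hΓ ρ) {F : ℍ → Fin p → ℂ} (hF : F ∈ cuspForms k v ρ) :
    ∃ A : ℝ, ∀ τ : ℍ, ‖F τ‖ * τ.im ^ (k / 2) ≤ A := by
  obtain ⟨N, hN⟩ := exists_common_period hv hfin hnormal
  have key : ∀ (c : SL(2, ℤ) ⧸ Γ) (j : Fin p), ∃ D : ℝ, 0 ≤ D ∧ ∀ τ : ℍ, 4 / 5 < τ.im →
      ‖slash k v c.out⁻¹ (fun τ ↦ F τ j) τ‖ * τ.im ^ (k / 2) ≤ D := fun c j ↦ by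
    have hN0 : (0 : ℝ) < N c := by exact_mod_cast (hN c).1
    have h0 := ((hF.1 j).2 c.out⁻¹).isZeroAtImInfty
    have hmd := mdifferentiable_slash (k := k) (v := v) (hF.1 j).1 c.out⁻¹
    have hper := fun τ ↦ (hN c).2 F hF τ j
    obtain ⟨B, hB⟩ := exists_norm_le_of_isZeroAtImInfty hN0 hper hmd h0
      (by norm_num : (0 : ℝ) < 2 / 5)
    have hcoeff : ∀ i < 0 + 1,
        (qExpansion (N c) (slash k v c.out⁻¹ fun τ ↦ F τ j)).coeff i = 0 := by
      intro i hi
      obtain rfl : i = 0 := by omega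
      rw [qExpansion_coeff_zero hN0 (analyticAt_cuspFunction_zero hN0 (periodic_comp_ofComplex hper)
        hmd h0.isBoundedAtImInfty) (periodic_comp_ofComplex hper)]
      exact h0.valueAtInfty_eq_zero
    obtain ⟨C, hC, hCy⟩ := exists_rpow_mul_exp_neg_le (s := k / 2) (b := 2 * Real.pi / N c)
      (by linarith) (by positivity)
    have hB0 : 0 ≤ B := (norm_nonneg _).trans (hB UpperHalfPlane.I (by norm_num))
    refine ⟨B * Real.exp (2 * Real.pi / N c * (2 / 5)) * C, by positivity, fun τ hτ ↦ ?_⟩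
    have h1 := norm_le_of_qExpansion_coeff_eq_zero hN0 hper hmd h0 hcoeff (by norm_num) hB
      (τ := τ) (by linarith)
    have h2 := hCy τ.im τ.im_pos.le
    have h3 : Real.exp (-2 * Real.pi * (τ.im - 2 / 5) / N c) ^ (0 + 1) =
        Real.exp (2 * Real.pi / N c * (2 / 5)) * Real.exp (-(2 * Real.pi / N c * τ.im)) := by
      rw [zero_add, pow_one, ← Real.exp_add]
      congr 1
      ring
    rw [h3] at h1
    calc _ ≤ B * (Real.exp (2 * Real.pi / N c * (2 / 5)) * Real.exp (-(2 * Real.pi / N c * τ.im))) *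
          τ.im ^ (k / 2) := by
          gcongr
      _ = B * Real.exp (2 * Real.pi / N c * (2 / 5)) *
          (τ.im ^ (k / 2) * Real.exp (-(2 * Real.pi / N c * τ.im))) := by ring
      _ ≤ _ := by gcongr
  choose D hD0 hD using key
  have := Fintype.ofFinite (SL(2, ℤ) ⧸ Γ)
  refine ⟨p * ∑ c, ∑ j, D c j, norm_mul_im_rpow_le hv hρ hF.2 fun c τ hτ ↦ ?_⟩
  refine norm_slash_le_of_comp (Finset.sum_nonneg fun c _ ↦ Finset.sum_nonneg fun j _ ↦ hD0 c j)
    fun j ↦ (hD c j τ hτ).trans ?_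
  exact (Finset.single_le_sum (f := fun j ↦ D c j) (fun j _ ↦ hD0 c j) (Finset.mem_univ j)).trans
    (Finset.single_le_sum (f := fun c ↦ ∑ j, D c j)
      (fun c _ ↦ Finset.sum_nonneg fun j _ ↦ hD0 c j) (Finset.mem_univ c))

/-- A Sturm bound: a cusp form all of whose Fourier expansions vanish to high order is zero. -/
lemma exists_sturm_bound (hk : 2 < k) (hv : IsMultiplierSystem k v)
    (hfin : Γ.FiniteIndex) {hΓ : -1 ∈ Γ} {ρ : Γ →* GL (Fin p) ℂ} (hρ : IsUnitary ρ)
    (hnormal : IsNormal v hΓ ρ) {N : (SL(2, ℤ) ⧸ Γ) → ℕ}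
    (hN : ∀ c, 0 < N c ∧ ∀ F ∈ cuspForms k v ρ, ∀ (τ : ℍ) (j : Fin p),
      slash k v c.out⁻¹ (fun τ ↦ F τ j) ((N c : ℝ) +ᵥ τ) =
        slash k v c.out⁻¹ (fun τ ↦ F τ j) τ) :
    ∃ m : (SL(2, ℤ) ⧸ Γ) → ℕ, ∀ F ∈ cuspForms k v ρ,
      (∀ c j, ∀ i < m c + 1, (qExpansion (N c) (slash k v c.out⁻¹ fun τ ↦ F τ j)).coeff i = 0) →
        F = 0 := by
  have hp : (0 : ℝ) < p + 1 := by positivity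
  have hN0 : ∀ c, (0 : ℝ) < N c := fun c ↦ by exact_mod_cast (hN c).1
  -- The height `y₀ = 2 / 5` is half of `4 / 5`, as the decay lemma requires. The value of `ε`
  -- compensates the factor `p` of `norm_mul_im_rpow_le` and gains a further `1 / 2`; `p + 1` keeps
  -- the denominator positive for `p = 0`.
  choose m hm using fun c ↦ exists_pow_decay_le (s := k / 2) (c := 2 * Real.pi / N c)
    (y₀ := 2 / 5) (ε := 1 / (2 * (p + 1))) (by linarith) (div_pos (by positivity) (hN0 c))
    (by norm_num) (by positivity)
  refine ⟨m, fun F hF hcoeff ↦ ?_⟩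
  -- A global bound `A` controls the translates above `y₀`; the Schwarz lemma improves this above `2
  -- y₀`, which covers the fundamental domain, and equivariance spreads the better bound over `ℍ`.
  -- Iteration forces `F = 0`.
  have half : ∀ A : ℝ, 0 ≤ A → (∀ τ : ℍ, ‖F τ‖ * τ.im ^ (k / 2) ≤ A) →
      ∀ τ : ℍ, ‖F τ‖ * τ.im ^ (k / 2) ≤ A / 2 := by
    intro A hA0 hA τ
    have h1 := norm_mul_im_rpow_le hv hρ hF.2 (D := A * (1 / (2 * (p + 1)))) (fun c τ hτ ↦ ?_) τ
    · refine h1.trans ?_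
      rw [mul_one_div, mul_div_assoc', div_le_div_iff₀ (by positivity) two_pos]
      nlinarith
    · refine norm_slash_le_of_comp (by positivity) fun j ↦ ?_
      have hB : ∀ z : ℍ, 2 / 5 < z.im → ‖slash k v c.out⁻¹ (fun τ ↦ F τ j) z‖ ≤
          A * (2 / 5 : ℝ) ^ (-(k / 2)) := fun z hz ↦ by
        have e1 := hA (c.out⁻¹ • z)
        rw [← norm_slash_mul_im_rpow hv] at e1
        have e2 : ‖slash k v c.out⁻¹ (fun τ ↦ F τ j) z‖ ≤ ‖slash k v c.out⁻¹ F z‖ :=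
          norm_le_pi_norm (slash k v c.out⁻¹ F z) j
        have e3 : (2 / 5 : ℝ) ^ (k / 2) ≤ z.im ^ (k / 2) :=
          Real.rpow_le_rpow (by norm_num) hz.le (by linarith)
        rw [Real.rpow_neg (by norm_num), ← div_eq_mul_inv, le_div_iff₀ (by positivity)]
        exact (mul_le_mul e2 e3 (by positivity) (norm_nonneg _)).trans e1
      have h2 := norm_le_of_qExpansion_coeff_eq_zero (hN0 c) (fun τ ↦ (hN c).2 F hF τ j)
        (mdifferentiable_slash (hF.1 j).1 c.out⁻¹) ((hF.1 j).2 c.out⁻¹).isZeroAtImInfty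
        (hcoeff c j) (by norm_num) hB (τ := τ) (by linarith)
      have h3 := hm c τ.im (by linarith)
      have h4 : -2 * Real.pi * (τ.im - 2 / 5) / N c = -(2 * Real.pi / N c * (τ.im - 2 / 5)) := by
        ring
      rw [h4] at h2
      calc _ ≤ (A * (2 / 5 : ℝ) ^ (-(k / 2)) *
            Real.exp (-(2 * Real.pi / N c * (τ.im - 2 / 5))) ^ (m c + 1)) * τ.im ^ (k / 2) := by
            gcongr
        _ = A * (τ.im ^ (k / 2) * (2 / 5 : ℝ) ^ (-(k / 2)) *
            Real.exp (-(2 * Real.pi / N c * (τ.im - 2 / 5))) ^ (m c + 1)) := by ring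
        _ ≤ _ := by gcongr
  obtain ⟨A, hA⟩ := exists_bound_of_mem_cuspForms hk hv hfin hρ hnormal hF
  have hA0 : 0 ≤ A :=
    (mul_nonneg (norm_nonneg _) (Real.rpow_nonneg UpperHalfPlane.I.im_pos.le _)).trans
    (hA UpperHalfPlane.I)
  have hall : ∀ n : ℕ, ∀ τ : ℍ, ‖F τ‖ * τ.im ^ (k / 2) ≤ A * (1 / 2) ^ n := by
    intro n
    induction n with
    | zero => simpa using hA
    | succ n ih =>
      intro τ
      refine (half _ (by positivity) ih τ).trans_eq ?_
      rw [pow_succ]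
      ring
  ext1 τ
  have hlim : Tendsto (fun n : ℕ ↦ A * (1 / 2 : ℝ) ^ n) atTop (𝓝 0) := by
    simpa using (tendsto_pow_atTop_nhds_zero_of_lt_one (r := (1 / 2 : ℝ)) (by norm_num)
      (by norm_num)).const_mul A
  have h0 := ge_of_tendsto' hlim fun n ↦ hall n τ
  have hpos : 0 < τ.im ^ (k / 2) := Real.rpow_pos_of_pos τ.im_pos _
  have : ‖F τ‖ ≤ 0 := by
    by_contra! h
    exact absurd h0 (not_le.mpr (mul_pos h hpos))
  simpa using this

/-- By the Sturm bound, finitely many Fourier coefficients determine a cusp form linearly. -/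
theorem finiteDimensional_cuspForms (hk : 2 < k) (hv : IsMultiplierSystem k v)
    (hfin : Γ.FiniteIndex) {hΓ : -1 ∈ Γ} {ρ : Γ →* GL (Fin p) ℂ} (hρ : IsUnitary ρ)
    (hnormal : IsNormal v hΓ ρ) : FiniteDimensional ℂ (cuspForms k v ρ) := by
  obtain ⟨N, hN⟩ := exists_common_period hv hfin hnormal
  obtain ⟨m, hm⟩ := exists_sturm_bound hk hv hfin hρ hnormal hN
  have han : ∀ (F : cuspForms k v ρ) (c : SL(2, ℤ) ⧸ Γ) (j : Fin p),
      AnalyticAt ℂ (cuspFunction (N c) (slash k v c.out⁻¹ fun τ ↦ F.1 τ j)) 0 := fun F c j ↦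
    analyticAt_cuspFunction_zero (by exact_mod_cast (hN c).1)
      (periodic_comp_ofComplex fun τ ↦ (hN c).2 F.1 F.2 τ j)
      (mdifferentiable_slash (F.2.1 j).1 c.out⁻¹)
      ((F.2.1 j).2 c.out⁻¹).isZeroAtImInfty.isBoundedAtImInfty
  let L : cuspForms k v ρ →ₗ[ℂ] ((c : SL(2, ℤ) ⧸ Γ) × Fin (m c + 1)) × Fin p → ℂ :=
    { toFun := fun F x ↦
        (qExpansion (N x.1.1) (slash k v x.1.1.out⁻¹ fun τ ↦ F.1 τ x.2)).coeff x.1.2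
      map_add' := fun F G ↦ by
        ext x
        have : (slash k v x.1.1.out⁻¹ fun τ ↦ (F + G).1 τ x.2) =
            slash k v x.1.1.out⁻¹ (fun τ ↦ F.1 τ x.2) +
              slash k v x.1.1.out⁻¹ fun τ ↦ G.1 τ x.2 := by
          ext τ
          simp [slash, mul_add]
        simp only [Pi.add_apply]
        rw [this, qExpansion_add (han F _ _) (han G _ _), map_add]
      map_smul' := fun a F ↦ by
        ext x
        have : (slash k v x.1.1.out⁻¹ fun τ ↦ (a • F).1 τ x.2) =
            a • slash k v x.1.1.out⁻¹ (fun τ ↦ F.1 τ x.2) := by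
          ext τ
          simp only [slash, SetLike.val_smul, Pi.smul_apply, smul_eq_mul]
          ring
        simp only [Pi.smul_apply, RingHom.id_apply]
        rw [this, qExpansion_smul (han F _ _), PowerSeries.coeff_smul, smul_eq_mul] }
  refine FiniteDimensional.of_injective L ((injective_iff_map_eq_zero L).mpr fun F hF ↦ ?_)
  refine Subtype.ext (hm F.1 F.2 fun c j i hi ↦ ?_)
  exact congrFun hF (⟨c, ⟨i, hi⟩⟩, j)

end Finite

end VVMF
end

noncomputable section

namespace VVMF

open Filter Topology MeasureTheory Set Metric

/-! ### Moments of holomorphic functions on the unit disc. -/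

section Disc

/-- On the circle `conj w = r² / w`, which turns the integral into Cauchy's formula for the `ν`-th
derivative. -/
lemma integral_conj_pow_mul_circle {G : ℂ → ℂ} (hG : DifferentiableOn ℂ G (ball 0 1)) (ν : ℕ)
    {r : ℝ} (hr0 : 0 < r) (hr1 : r < 1) :
    ∫ θ in (-Real.pi)..Real.pi, (starRingEnd ℂ) (circleMap 0 r θ) ^ ν * G (circleMap 0 r θ) =
      2 * Real.pi * r ^ (2 * ν) * (iteratedDeriv ν G 0 / ν.factorial) := by
  have h1 := (hG.mono (closedBall_subset_ball hr1)).circleIntegral_one_div_sub_center_pow_smul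
    hr0 ν
  have hper : Function.Periodic
      (fun θ ↦ (starRingEnd ℂ) (circleMap 0 r θ) ^ ν * G (circleMap 0 r θ)) (2 * Real.pi) :=
    fun θ ↦ by simp only [periodic_circleMap 0 r θ]
  have h2 := hper.intervalIntegral_add_eq (-Real.pi) 0
  rw [show -Real.pi + 2 * Real.pi = Real.pi by ring, zero_add] at h2
  rw [h2]
  have hr : (r : ℂ) ≠ 0 := by exact_mod_cast hr0.ne'
  rw [circleIntegral] at h1
  have h3 : ∀ θ : ℝ, deriv (circleMap 0 r) θ • (1 / (circleMap 0 r θ - 0) ^ (ν + 1)) •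
      G (circleMap 0 r θ) = (Complex.I * (r : ℂ)⁻¹ ^ (2 * ν)) *
        ((starRingEnd ℂ) (circleMap 0 r θ) ^ ν * G (circleMap 0 r θ)) := fun θ ↦ by
    have hz : circleMap 0 r θ ≠ 0 := circleMap_ne_center hr0.ne'
    have hc : (starRingEnd ℂ) (circleMap 0 r θ) = r ^ 2 * (circleMap 0 r θ)⁻¹ := by
      rw [Complex.inv_def, Complex.normSq_eq_norm_sq, norm_circleMap_zero, abs_of_pos hr0]
      push_cast
      field_simp
    rw [deriv_circleMap, hc, sub_zero]
    simp only [smul_eq_mul, mul_pow, ← pow_mul, inv_pow]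
    field_simp
    ring
  simp only [h3, intervalIntegral.integral_const_mul] at h1
  have hI := Complex.I_ne_zero
  have h4 : (Complex.I * (r : ℂ)⁻¹ ^ (2 * ν)) ≠ 0 := mul_ne_zero hI (pow_ne_zero _ (inv_ne_zero hr))
  refine mul_left_cancel₀ h4 (h1.trans ?_)
  rw [smul_eq_mul, inv_pow]
  field_simp

/-- In polar coordinates the integral splits into the Taylor coefficient times a strictly positive
radial integral. -/
lemma iteratedDeriv_eq_zero_of_integral_eq_zero {β : ℝ} (hβ : 0 ≤ β) {G : ℂ → ℂ}
    (hG : DifferentiableOn ℂ G (ball 0 1)) (ν : ℕ)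
    (hint : IntegrableOn (fun w : ℂ ↦ ((1 - ‖w‖ ^ 2) ^ β : ℝ) • ((starRingEnd ℂ) w ^ ν * G w))
      (ball 0 1))
    (h0 : ∫ w in ball (0 : ℂ) 1, ((1 - ‖w‖ ^ 2) ^ β : ℝ) • ((starRingEnd ℂ) w ^ ν * G w) = 0) :
    iteratedDeriv ν G 0 = 0 := by
  -- Extension by zero makes the polar coordinate formula on the whole plane applicable.
  set f : ℂ → ℂ := (ball (0 : ℂ) 1).indicator
    fun w ↦ ((1 - ‖w‖ ^ 2) ^ β : ℝ) • ((starRingEnd ℂ) w ^ ν * G w) with hf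
  have hcont : ContinuousOn (fun w : ℂ ↦ ((1 - ‖w‖ ^ 2) ^ β : ℝ) • ((starRingEnd ℂ) w ^ ν * G w))
      (ball 0 1) := by
    have h1 : ContinuousOn (fun w : ℂ ↦ (1 - ‖w‖ ^ 2) ^ β) (ball 0 1) :=
      ContinuousOn.rpow_const (by fun_prop) fun w _ ↦ Or.inr hβ
    have h2 : ContinuousOn (fun w : ℂ ↦ (starRingEnd ℂ) w ^ ν * G w) (ball 0 1) :=
      (Complex.continuous_conj.pow ν).continuousOn.mul hG.continuousOn
    exact h1.smul h2
  have hfm : Measurable f := by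
    classical
    rw [hf, ← piecewise_eq_indicator]
    exact hcont.measurable_piecewise (g := 0) continuousOn_const measurableSet_ball
  have hfint : Integrable f := (integrable_indicator_iff measurableSet_ball).mpr hint
  have hf0 : ∫ w, f w = 0 := by rw [hf, integral_indicator measurableSet_ball, h0]
  rw [← Complex.integral_comp_polarCoord_symm] at hf0
  have hpolar : IntegrableOn (fun p : ℝ × ℝ ↦ p.1 • f (Complex.polarCoord.symm p))
      (Ioi (0 : ℝ) ×ˢ Ioo (-Real.pi) Real.pi) := by
    refine ⟨?_, ?_⟩
    · have hm : Measurable fun p : ℝ × ℝ ↦ Complex.polarCoord.symm p := by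
        simp only [Complex.polarCoord_symm_apply]
        fun_prop
      exact (measurable_fst.smul (hfm.comp hm)).aestronglyMeasurable
    · have h1 := Complex.lintegral_comp_polarCoord_symm fun w ↦ ‖f w‖ₑ
      have h2 : ∫⁻ p in Ioi (0 : ℝ) ×ˢ Ioo (-Real.pi) Real.pi,
          ‖p.1 • f (Complex.polarCoord.symm p)‖ₑ = ∫⁻ w, ‖f w‖ₑ := by
        rw [← h1, polarCoord_target]
        refine setLIntegral_congr_fun (measurableSet_Ioi.prod measurableSet_Ioo) fun p hp ↦ ?_
        simp only [enorm_smul, smul_eq_mul]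
        rw [Real.enorm_of_nonneg (le_of_lt hp.1)]
      rw [hasFiniteIntegral_iff_enorm, h2]
      exact hfint.2
  rw [polarCoord_target, Measure.volume_eq_prod, setIntegral_prod _ hpolar] at hf0
  set c : ℝ → ℝ := fun r ↦ 2 * Real.pi * r ^ (2 * ν + 1) * (1 - r ^ 2) ^ β with hc
  have hinner : ∀ r ∈ Ioi (0 : ℝ), ∫ θ in Ioo (-Real.pi) Real.pi,
      r • f (Complex.polarCoord.symm (r, θ)) =
        (Ioo (0 : ℝ) 1).indicator (fun r ↦ (c r : ℂ) * (iteratedDeriv ν G 0 / ν.factorial)) r := by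
    intro r hr
    have hr0 : (0 : ℝ) < r := hr
    have hcirc : ∀ θ : ℝ, Complex.polarCoord.symm (r, θ) = circleMap 0 r θ := fun θ ↦ by
      rw [Complex.polarCoord_symm_apply, circleMap, Complex.exp_mul_I, zero_add]
      push_cast
      rfl
    simp only [hcirc]
    by_cases hr1 : r < 1
    · have hmem : ∀ θ, circleMap 0 r θ ∈ ball (0 : ℂ) 1 := fun θ ↦ by
        rw [mem_ball_zero_iff, norm_circleMap_zero, abs_of_pos hr0]
        exact hr1
      rw [indicator_of_mem (show r ∈ Ioo (0 : ℝ) 1 from ⟨hr0, hr1⟩)]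
      have : ∀ θ, r • f (circleMap 0 r θ) = ((r * (1 - r ^ 2) ^ β : ℝ) : ℂ) *
          ((starRingEnd ℂ) (circleMap 0 r θ) ^ ν * G (circleMap 0 r θ)) := fun θ ↦ by
        rw [hf, indicator_of_mem (hmem θ), norm_circleMap_zero, sq_abs, smul_smul,
          Complex.real_smul]
      simp only [this]
      rw [← integral_Ioc_eq_integral_Ioo, ← intervalIntegral.integral_of_le
        (by linarith [Real.pi_pos]), intervalIntegral.integral_const_mul,
        integral_conj_pow_mul_circle hG ν hr0 hr1, hc]
      push_cast
      ring
    · have hmem : ∀ θ, circleMap 0 r θ ∉ ball (0 : ℂ) 1 := fun θ ↦ by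
        rw [mem_ball_zero_iff, norm_circleMap_zero, abs_of_pos hr0]
        exact hr1
      rw [indicator_of_notMem (fun h ↦ hr1 h.2)]
      simp [hf, indicator_of_notMem (hmem _)]
  rw [setIntegral_congr_fun measurableSet_Ioi hinner, setIntegral_indicator measurableSet_Ioo,
    show Ioi (0 : ℝ) ∩ Ioo 0 1 = Ioo 0 1 from inter_eq_right.mpr fun x hx ↦ hx.1,
    integral_mul_const, integral_complex_ofReal] at hf0
  have hcc : Continuous c := by
    have : Continuous fun r : ℝ ↦ (1 - r ^ 2) ^ β :=
      Continuous.rpow_const (by fun_prop) fun _ ↦ Or.inr hβ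
    exact (by fun_prop : Continuous fun r : ℝ ↦ 2 * Real.pi * r ^ (2 * ν + 1)).mul this
  have hpos : 0 < ∫ r in Ioo (0 : ℝ) 1, c r := by
    rw [← integral_Ioc_eq_integral_Ioo, ← intervalIntegral.integral_of_le zero_le_one]
    refine intervalIntegral.intervalIntegral_pos_of_pos_on (hcc.intervalIntegrable 0 1)
      (fun r hr ↦ ?_) one_pos
    have h1 : 0 < 1 - r ^ 2 := by nlinarith [hr.1, hr.2]
    have := hr.1
    positivity
  have hne : (((∫ r in Ioo (0 : ℝ) 1, c r : ℝ)) : ℂ) ≠ 0 := by exact_mod_cast hpos.ne'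
  have h5 := (mul_eq_zero.mp hf0).resolve_left hne
  exact (div_eq_zero_iff.mp h5).resolve_right (by exact_mod_cast ν.factorial_ne_zero)

lemma eq_zero_of_integral_conj_pow_eq_zero {β : ℝ} (hβ : 0 ≤ β) {G : ℂ → ℂ}
    (hG : DifferentiableOn ℂ G (ball 0 1))
    (hint : ∀ ν : ℕ, IntegrableOn
      (fun w : ℂ ↦ ((1 - ‖w‖ ^ 2) ^ β : ℝ) • ((starRingEnd ℂ) w ^ ν * G w)) (ball 0 1))
    (h0 : ∀ ν : ℕ, ∫ w in ball (0 : ℂ) 1,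
      ((1 - ‖w‖ ^ 2) ^ β : ℝ) • ((starRingEnd ℂ) w ^ ν * G w) = 0)
    {w : ℂ} (hw : w ∈ ball (0 : ℂ) 1) : G w = 0 := by
  have h1 := Complex.hasSum_taylorSeries_on_ball hG hw
  simp only [iteratedDeriv_eq_zero_of_integral_eq_zero hβ hG _ (hint _) (h0 _), smul_zero] at h1
  exact h1.unique hasSum_zero

/-- In the radial variable `(1 - r²)^β = (1 + r)^β (1 - r)^β`; the first factor is at most `2 ^
|β|`, and the second is integrable exactly for `β > -1`. -/
lemma integrableOn_one_sub_norm_sq_rpow {β : ℝ} (hβ : -1 < β) :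
    IntegrableOn (fun w : ℂ ↦ (1 - ‖w‖ ^ 2) ^ β) (ball 0 1) := by
  rw [integrableOn_fun_norm_addHaar volume (f := fun r : ℝ ↦ (1 - r ^ 2) ^ β)]
  have h1 : IntegrableOn (fun r : ℝ ↦ (1 - r) ^ β) (Ioo 0 1) := by
    have h2 := (intervalIntegral.intervalIntegrable_rpow' (a := 1) (b := 0) hβ).comp_sub_left 1
    simp only [sub_self, sub_zero] at h2
    rw [intervalIntegrable_iff_integrableOn_Ioo_of_le zero_le_one] at h2
    exact h2
  refine (h1.const_mul (2 ^ |β|)).mono' ?_ ?_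
  · refine ContinuousOn.aestronglyMeasurable ?_ measurableSet_Ioo
    have h2 : ContinuousOn (fun r : ℝ ↦ (1 - r ^ 2) ^ β) (Ioo 0 1) := by
      refine ContinuousOn.rpow_const (by fun_prop) fun r hr ↦ Or.inl ?_
      nlinarith [hr.1, hr.2]
    exact (continuous_pow _).continuousOn.smul h2
  · filter_upwards [ae_restrict_mem measurableSet_Ioo] with r hr
    have h3 : 0 < 1 - r := by linarith [hr.2]
    have h4 : (0 : ℝ) < 1 + r := by linarith [hr.1]
    rw [Complex.finrank_real_complex, smul_eq_mul, norm_mul,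
      show 1 - r ^ 2 = (1 + r) * (1 - r) by ring,
      Real.mul_rpow h4.le h3.le, Real.norm_of_nonneg (by have := hr.1; positivity),
      Real.norm_of_nonneg (by positivity)]
    have h5 : (1 + r) ^ β ≤ 2 ^ |β| :=
      (Real.rpow_le_rpow_of_exponent_le (by linarith [hr.1]) (le_abs_self β)).trans
        (Real.rpow_le_rpow h4.le (by linarith [hr.2]) (abs_nonneg _))
    have h6 : r ^ (2 - 1) ≤ 1 := by simpa using hr.2.le
    calc _ ≤ 1 * (2 ^ |β| * (1 - r) ^ β) := by
          have := hr.1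
          gcongr
      _ = _ := one_mul _

end Disc

end VVMF
end

noncomputable section

namespace VVMF

open Filter Topology MeasureTheory Set Metric

/-! ### Transport of integrals from the half-plane to the disc. -/

section Cayley

variable {E : Type*} [NormedAddCommGroup E] [NormedSpace ℝ E]

lemma measurePreserving_coe_comap :
    MeasurePreserving UpperHalfPlane.coe (volume.comap UpperHalfPlane.coe)
      (volume.restrict {z : ℂ | 0 < z.im}) := by
  refine ⟨measurable_coe, ?_⟩
  rw [measurableEmbedding_coe.map_comap]
  congr 1
  exact UpperHalfPlane.range_coe

lemma measurable_density :
    Measurable fun z : ℍ ↦ (1 / NNReal.mk z.im z.im_pos.le : NNReal) ^ 2 := by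
  have : Measurable fun z : ℍ ↦ NNReal.mk z.im z.im_pos.le :=
    Measurable.subtype_mk continuous_im.measurable
  exact (this.const_div 1).pow_const 2

lemma integrable_iff_integrableOn_complex (φ : ℍ → E) :
    Integrable φ ↔
      IntegrableOn (fun z : ℂ ↦ ((1 / z.im) ^ 2 : ℝ) • φ (ofComplex z)) {z | 0 < z.im} := by
  rw [volume_def, integrable_withDensity_iff_integrable_smul measurable_density, IntegrableOn,
    ← measurePreserving_coe_comap.integrable_comp_emb measurableEmbedding_coe]
  refine integrable_congr (Eventually.of_forall fun z ↦ ?_)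
  simp only [Function.comp, ofComplex_apply, coe_im, NNReal.smul_def]
  rfl

lemma integral_eq_integral_complex (φ : ℍ → E) :
    ∫ τ, φ τ = ∫ z in {z : ℂ | 0 < z.im}, ((1 / z.im) ^ 2 : ℝ) • φ (ofComplex z) := by
  rw [volume_def, integral_withDensity_eq_integral_smul measurable_density,
    ← measurePreserving_coe_comap.integral_comp measurableEmbedding_coe]
  refine integral_congr_ae (Eventually.of_forall fun z ↦ ?_)
  simp only [ofComplex_apply, coe_im, NNReal.smul_def]
  rfl

/-- The biholomorphic map from the unit disc to the upper half-plane that sends `0` to `ξ`, the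
inverse of `τ ↦ (τ - ξ) / (τ - conj ξ)`. -/
def discMap (ξ : ℍ) (w : ℂ) : ℂ := (ξ - (starRingEnd ℂ) ξ * w) / (1 - w)

lemma one_sub_ne_zero {w : ℂ} (hw : w ∈ ball (0 : ℂ) 1) : 1 - w ≠ 0 := by
  intro h
  rw [mem_ball_zero_iff, ← sub_eq_zero.mp h, norm_one] at hw
  exact lt_irrefl _ hw

lemma sub_conj_eq (ξ : ℍ) : (ξ : ℂ) - (starRingEnd ℂ) ξ = 2 * ξ.im * Complex.I := by
  apply Complex.ext <;> simp
  ring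

lemma discMap_sub_conj (ξ : ℍ) {w : ℂ} (hw : w ∈ ball (0 : ℂ) 1) :
    discMap ξ w - (starRingEnd ℂ) ξ = 2 * ξ.im * Complex.I / (1 - w) := by
  have := one_sub_ne_zero hw
  rw [discMap, ← sub_conj_eq]
  field_simp
  ring

lemma discMap_sub (ξ : ℍ) {w : ℂ} (hw : w ∈ ball (0 : ℂ) 1) :
    discMap ξ w - ξ = w * (discMap ξ w - (starRingEnd ℂ) ξ) := by
  have := one_sub_ne_zero hw
  rw [discMap]
  field_simp
  ring

lemma im_discMap (ξ : ℍ) {w : ℂ} (hw : w ∈ ball (0 : ℂ) 1) :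
    (discMap ξ w).im = ξ.im * (1 - ‖w‖ ^ 2) / ‖1 - w‖ ^ 2 := by
  have h := one_sub_ne_zero hw
  have h1 : discMap ξ w = (starRingEnd ℂ) ξ + 2 * ξ.im * Complex.I / (1 - w) := by
    rw [← discMap_sub_conj ξ hw]
    ring
  have h2 : ‖1 - w‖ ^ 2 ≠ 0 := by positivity
  rw [h1, Complex.add_im, Complex.div_im, Complex.normSq_eq_norm_sq]
  rw [← Complex.normSq_eq_norm_sq] at h2 ⊢
  rw [← Complex.normSq_eq_norm_sq w]
  field_simp
  simp [Complex.normSq_apply]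
  ring

lemma im_discMap_pos (ξ : ℍ) {w : ℂ} (hw : w ∈ ball (0 : ℂ) 1) : 0 < (discMap ξ w).im := by
  rw [im_discMap ξ hw]
  have h := norm_pos_iff.mpr (one_sub_ne_zero hw)
  have h1 : ‖w‖ < 1 := by simpa using hw
  have h2 : 0 < 1 - ‖w‖ ^ 2 := by nlinarith [norm_nonneg w]
  have := ξ.im_pos
  positivity

lemma hasDerivAt_discMap (ξ : ℍ) {w : ℂ} (hw : w ∈ ball (0 : ℂ) 1) :
    HasDerivAt (discMap ξ) (2 * ξ.im * Complex.I / (1 - w) ^ 2) w := by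
  have h := one_sub_ne_zero hw
  have h1 : HasDerivAt (fun w : ℂ ↦ (ξ : ℂ) - (starRingEnd ℂ) ξ * w) (-((starRingEnd ℂ) ξ)) w := by
    simpa using ((hasDerivAt_id w).const_mul ((starRingEnd ℂ) (ξ : ℂ))).const_sub (ξ : ℂ)
  have h2 : HasDerivAt (fun w : ℂ ↦ 1 - w) (-1) w := by
    simpa using (hasDerivAt_id w).const_sub (1 : ℂ)
  refine (h1.div h2 h).congr_deriv ?_
  rw [← sub_conj_eq]
  ring

lemma discMap_div (ξ τ : ℍ) :
    ((τ : ℂ) - ξ) / (τ - (starRingEnd ℂ) ξ) ∈ ball (0 : ℂ) 1 ∧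
      discMap ξ (((τ : ℂ) - ξ) / (τ - (starRingEnd ℂ) ξ)) = τ := by
  have h0 := sub_conj_ne_zero τ ξ
  have h1 := sub_conj_ne_zero ξ ξ
  refine ⟨?_, ?_⟩
  · rw [mem_ball_zero_iff, norm_div, div_lt_one (norm_pos_iff.mpr h0),
      ← sq_lt_sq₀ (norm_nonneg _) (norm_nonneg _), ← Complex.normSq_eq_norm_sq,
      ← Complex.normSq_eq_norm_sq, Complex.normSq_apply, Complex.normSq_apply]
    simp only [Complex.sub_re, Complex.sub_im, Complex.conj_re, Complex.conj_im, coe_re, coe_im]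
    nlinarith [mul_pos τ.im_pos ξ.im_pos]
  · have h2 : 1 - ((τ : ℂ) - ξ) / (τ - (starRingEnd ℂ) ξ) =
        ((ξ : ℂ) - (starRingEnd ℂ) ξ) / (τ - (starRingEnd ℂ) ξ) := by
      field_simp
      ring
    rw [discMap, h2]
    field_simp
    ring

lemma injOn_discMap (ξ : ℍ) : InjOn (discMap ξ) (ball (0 : ℂ) 1) := by
  intro a ha b hb hab
  have h1 := discMap_sub ξ ha
  have h2 := discMap_sub ξ hb
  rw [hab] at h1
  have h3 : discMap ξ b - (starRingEnd ℂ) ξ ≠ 0 := by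
    have := sub_conj_ne_zero ⟨discMap ξ b, im_discMap_pos ξ hb⟩ ξ
    exact this
  exact mul_right_cancel₀ h3 (h1.symm.trans h2)

lemma image_discMap (ξ : ℍ) : discMap ξ '' ball (0 : ℂ) 1 = {z | 0 < z.im} := by
  ext z
  constructor
  · rintro ⟨w, hw, rfl⟩
    exact im_discMap_pos ξ hw
  · intro hz
    obtain ⟨h1, h2⟩ := discMap_div ξ ⟨z, hz⟩
    exact ⟨_, h1, h2⟩

lemma hasFDerivWithinAt_discMap (ξ : ℍ) {w : ℂ} (hw : w ∈ ball (0 : ℂ) 1) :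
    HasFDerivWithinAt (discMap ξ) ((ContinuousLinearMap.toSpanSingleton ℂ
      (2 * ξ.im * Complex.I / (1 - w) ^ 2)).restrictScalars ℝ) (ball 0 1) w :=
  ((hasDerivAt_discMap ξ hw).hasFDerivAt.restrictScalars ℝ).hasFDerivWithinAt

lemma abs_det_toSpanSingleton (a : ℂ) :
    |((ContinuousLinearMap.toSpanSingleton ℂ a).restrictScalars ℝ).det| = ‖a‖ ^ 2 := by
  simp [ContinuousLinearMap.det, LinearMap.det_restrictScalars,
      Algebra.norm_complex_eq, Complex.normSq_eq_norm_sq]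

/-- Jacobian times `y⁻²`: the hyperbolic area density in the disc model, independent of `ξ`. -/
lemma density_discMap (ξ : ℍ) {w : ℂ} (hw : w ∈ ball (0 : ℂ) 1) :
    ‖2 * ξ.im * Complex.I / (1 - w) ^ 2‖ ^ 2 * (1 / (discMap ξ w).im) ^ 2 =
      4 * (1 - ‖w‖ ^ 2) ^ (-2 : ℝ) := by
  have h := norm_pos_iff.mpr (one_sub_ne_zero hw)
  have h1 : ‖w‖ < 1 := by simpa using hw
  have h2 : 0 < 1 - ‖w‖ ^ 2 := by nlinarith [norm_nonneg w]
  have h3 := ξ.im_pos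
  rw [im_discMap ξ hw, norm_div, norm_mul, norm_mul, norm_pow, Complex.norm_I, Complex.norm_ofNat,
    Complex.norm_real, Real.norm_of_nonneg h3.le, Real.rpow_neg h2.le, Real.rpow_ofNat]
  field_simp
  norm_num

lemma integrable_iff_integrableOn_disc (ξ : ℍ) (φ : ℍ → E) :
    Integrable φ ↔ IntegrableOn
      (fun w : ℂ ↦ (4 * (1 - ‖w‖ ^ 2) ^ (-2 : ℝ)) • φ (ofComplex (discMap ξ w))) (ball 0 1) := by
  rw [integrable_iff_integrableOn_complex, ← image_discMap ξ,
    integrableOn_image_iff_integrableOn_abs_det_fderiv_smul volume measurableSet_ball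
      (fun w hw ↦ hasFDerivWithinAt_discMap ξ hw) (injOn_discMap ξ)]
  refine integrableOn_congr_fun (fun w hw ↦ ?_) measurableSet_ball
  rw [abs_det_toSpanSingleton, smul_smul, density_discMap ξ hw]

lemma integral_eq_integral_disc (ξ : ℍ) (φ : ℍ → E) :
    ∫ τ, φ τ = ∫ w in ball (0 : ℂ) 1,
      (4 * (1 - ‖w‖ ^ 2) ^ (-2 : ℝ)) • φ (ofComplex (discMap ξ w)) := by
  rw [integral_eq_integral_complex, ← image_discMap ξ,
    integral_image_eq_integral_abs_det_fderiv_smul volume measurableSet_ball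
      (fun w hw ↦ hasFDerivWithinAt_discMap ξ hw) (injOn_discMap ξ)]
  refine setIntegral_congr_fun measurableSet_ball fun w hw ↦ ?_
  rw [abs_det_toSpanSingleton, smul_smul, density_discMap ξ hw]

/-- The powers of `|1 - w|` in the two factors cancel. The case `s = k / 2` serves integrability of
the kernel, `s = k` the pairing with seeds. -/
lemma norm_rpow_mul_im_rpow_discMap (ξ : ℍ) (s : ℝ) {w : ℂ} (hw : w ∈ ball (0 : ℂ) 1) :
    ‖discMap ξ w - (starRingEnd ℂ) ξ‖ ^ (-(2 * s)) * (discMap ξ w).im ^ s =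
      (4 * ξ.im) ^ (-s) * (1 - ‖w‖ ^ 2) ^ s := by
  have h := norm_pos_iff.mpr (one_sub_ne_zero hw)
  have h1 : ‖w‖ < 1 := by simpa using hw
  have h2 : 0 < 1 - ‖w‖ ^ 2 := by nlinarith [norm_nonneg w]
  have h3 := ξ.im_pos
  have h4 : ‖discMap ξ w - (starRingEnd ℂ) ξ‖ = 2 * ξ.im / ‖1 - w‖ := by
    rw [discMap_sub_conj ξ hw]
    simp [abs_of_pos h3]
  have h5 : (2 * ξ.im / ‖1 - w‖) ^ (-(2 * s)) = ((2 * ξ.im / ‖1 - w‖) ^ 2) ^ (-s) := by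
    rw [← Real.rpow_natCast, ← Real.rpow_mul (by positivity)]
    congr 1
    push_cast
    ring
  have h6 : (discMap ξ w).im ^ s = ((discMap ξ w).im⁻¹) ^ (-s) := by
    rw [Real.inv_rpow (im_discMap_pos ξ hw).le, Real.rpow_neg (im_discMap_pos ξ hw).le, inv_inv]
  have h7 : (1 - ‖w‖ ^ 2) ^ s = ((1 - ‖w‖ ^ 2)⁻¹) ^ (-s) := by
    rw [Real.inv_rpow h2.le, Real.rpow_neg h2.le, inv_inv]
  rw [h4, h5, h6, h7, im_discMap ξ hw, ← Real.mul_rpow (by positivity) (by positivity),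
    ← Real.mul_rpow (by positivity) (by positivity)]
  congr 1
  field_simp
  norm_num

/-- The kernel `|τ - conj ξ|^(-k) Im(τ)^(k / 2)` is integrable on the upper half-plane. -/
lemma integrable_kernel {k : ℝ} (hk : 2 < k) (ξ : ℍ) :
    Integrable fun τ : ℍ ↦ ‖(τ : ℂ) - (starRingEnd ℂ) ξ‖ ^ (-k) * τ.im ^ (k / 2) := by
  rw [integrable_iff_integrableOn_disc ξ]
  -- The exponent is `k / 2` from the kernel minus `2` from the area; it exceeds `-1` precisely
  -- because `k > 2`.
  have h1 := (integrableOn_one_sub_norm_sq_rpow (β := k / 2 - 2) (by linarith)).const_mul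
    (4 * (4 * ξ.im) ^ (-(k / 2)))
  refine (integrableOn_congr_fun (fun w hw ↦ ?_) measurableSet_ball).mp h1
  have h2 := norm_rpow_mul_im_rpow_discMap ξ (k / 2) hw
  rw [mul_div_cancel₀ _ two_ne_zero] at h2
  have h3 : ‖w‖ < 1 := by simpa using hw
  have h4 : 0 < 1 - ‖w‖ ^ 2 := by nlinarith [norm_nonneg w]
  have h5 : ((ofComplex (discMap ξ w) : ℍ) : ℂ) = discMap ξ w := by
    rw [ofComplex_apply_of_im_pos (im_discMap_pos ξ hw)]
  simp only [← coe_im, h5, h2, smul_eq_mul]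
  rw [sub_eq_add_neg (k / 2), Real.rpow_add h4]
  ring

/-- A holomorphic function of moderate growth that is orthogonal to all elliptic seeds is zero. -/
lemma eq_zero_of_integral_seed_eq_zero {k : ℝ} (hk : 2 < k) (ξ : ℍ) {g : ℍ → ℂ}
    (hg : MDifferentiable 𝓘(ℂ) 𝓘(ℂ) g)
    (hint : ∀ ν : ℕ, Integrable fun τ : ℍ ↦ (τ.im ^ k : ℝ) •
      ((starRingEnd ℂ) (((τ : ℂ) - ξ) ^ ν / ((τ : ℂ) - (starRingEnd ℂ) ξ) ^ ((ν : ℂ) + k)) * g τ))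
    (h0 : ∀ ν : ℕ, ∫ τ : ℍ, (τ.im ^ k : ℝ) •
      ((starRingEnd ℂ) (((τ : ℂ) - ξ) ^ ν / ((τ : ℂ) - (starRingEnd ℂ) ξ) ^ ((ν : ℂ) + k)) * g τ)
        = 0) : g = 0 := by
  -- The seed is `w ^ ν (τ - conj ξ)^(-k)`, and the conjugate of its second factor is `|τ - conj
  -- ξ|^(-2k) (τ - conj ξ)^k`. The holomorphic power is absorbed into `G`; the modulus combines with
  -- `y ^ k` to a multiple of `(1 - |w|²)^k`.
  set G : ℂ → ℂ := fun w ↦ (discMap ξ w - (starRingEnd ℂ) ξ) ^ (k : ℂ) *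
    (g ∘ ofComplex) (discMap ξ w) with hGdef
  have hG : DifferentiableOn ℂ G (ball 0 1) := by
    intro w hw
    have h1 := (hasDerivAt_discMap ξ hw).differentiableAt
    have h2 : DifferentiableAt ℂ (g ∘ ofComplex) (discMap ξ w) :=
      (UpperHalfPlane.mdifferentiable_iff.mp hg).differentiableAt
        (isOpen_upperHalfPlaneSet.mem_nhds (im_discMap_pos ξ hw))
    refine (DifferentiableAt.mul ?_ (h2.comp w h1)).differentiableWithinAt
    refine DifferentiableAt.cpow_const (h1.sub_const _) ?_
    refine Complex.mem_slitPlane_iff.mpr (Or.inr ?_)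
    have : 0 < (discMap ξ w - (starRingEnd ℂ) ξ).im := by
      simpa using add_pos (im_discMap_pos ξ hw) ξ.im_pos
    exact this.ne'
  have hpt : ∀ (ν : ℕ), ∀ w ∈ ball (0 : ℂ) 1,
      (4 * (1 - ‖w‖ ^ 2) ^ (-2 : ℝ)) • (fun τ : ℍ ↦ (τ.im ^ k : ℝ) •
        ((starRingEnd ℂ) (((τ : ℂ) - ξ) ^ ν /
          ((τ : ℂ) - (starRingEnd ℂ) ξ) ^ ((ν : ℂ) + k)) * g τ)) (ofComplex (discMap ξ w)) =
      (4 * (4 * ξ.im) ^ (-k)) •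
        (((1 - ‖w‖ ^ 2) ^ (k - 2) : ℝ) • ((starRingEnd ℂ) w ^ ν * G w)) := by
    intro ν w hw
    have h3 : ‖w‖ < 1 := by simpa using hw
    have h4 : 0 < 1 - ‖w‖ ^ 2 := by nlinarith [norm_nonneg w]
    set τ : ℍ := ⟨discMap ξ w, im_discMap_pos ξ hw⟩ with hτ
    have e1 : ofComplex (discMap ξ w) = τ := ofComplex_apply_of_im_pos (im_discMap_pos ξ hw)
    have e2 : (τ : ℂ) = discMap ξ w := rfl
    have hne := sub_conj_ne_zero τ ξ
    have e3 : ((τ : ℂ) - ξ) / ((τ : ℂ) - (starRingEnd ℂ) ξ) = w := by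
      rw [e2, discMap_sub ξ hw, ← e2, mul_div_cancel_right₀ _ hne]
    have e4 : G w = (((τ : ℂ) - (starRingEnd ℂ) ξ) ^ (k : ℂ)) * g τ := by
      simp only [hGdef, Function.comp_apply, e1, e2]
    have e5 : (starRingEnd ℂ) (((τ : ℂ) - (starRingEnd ℂ) ξ) ^ (-(k : ℂ))) =
        ((‖(τ : ℂ) - (starRingEnd ℂ) ξ‖ ^ (-(2 * k)) : ℝ) : ℂ) *
          ((τ : ℂ) - (starRingEnd ℂ) ξ) ^ (k : ℂ) := by
      set a := ((τ : ℂ) - (starRingEnd ℂ) ξ) ^ (k : ℂ) with ha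
      have ha0 : a ≠ 0 := by
        rw [ha, Ne, Complex.cpow_eq_zero_iff]
        exact fun h ↦ hne h.1
      have hna : ‖(τ : ℂ) - (starRingEnd ℂ) ξ‖ ^ (-(2 * k)) = (‖a‖ ^ 2)⁻¹ := by
        rw [ha, Complex.norm_cpow_real, Real.rpow_neg (norm_nonneg _), mul_comm 2 k,
          Real.rpow_mul (norm_nonneg _)]
        norm_num
      rw [Complex.cpow_neg, ← ha, map_inv₀, hna, Complex.inv_def, Complex.conj_conj,
        Complex.normSq_conj, Complex.normSq_eq_norm_sq, mul_comm]
    have e6 := norm_rpow_mul_im_rpow_discMap ξ k hw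
    have e7 : (discMap ξ w).im = τ.im := rfl
    rw [← e2, coe_im] at e6
    simp only [e1]
    rw [ellipticSeed_factor, e3, map_mul, map_pow, e5, e4, sub_eq_add_neg k 2, Real.rpow_add h4]
    simp only [Complex.real_smul]
    have e8 : ((‖(τ : ℂ) - (starRingEnd ℂ) ξ‖ ^ (-(2 * k)) : ℝ) : ℂ) * ((τ.im ^ k : ℝ) : ℂ) =
        (((4 * ξ.im) ^ (-k) : ℝ) : ℂ) * (((1 - ‖w‖ ^ 2) ^ k : ℝ) : ℂ) := by exact_mod_cast e6
    push_cast at e8 ⊢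
    linear_combination (4 * (((1 - ‖w‖ ^ 2) ^ (-2 : ℝ) : ℝ) : ℂ) * (starRingEnd ℂ) w ^ ν *
      ((τ : ℂ) - (starRingEnd ℂ) ξ) ^ (k : ℂ) * g τ) * e8
  have hc : (4 * (4 * ξ.im) ^ (-k)) ≠ 0 := by
    have := ξ.im_pos
    positivity
  have key : ∀ w ∈ ball (0 : ℂ) 1, G w = 0 := fun w hw ↦ by
    refine eq_zero_of_integral_conj_pow_eq_zero (β := k - 2) (by linarith) hG (fun ν ↦ ?_)
      (fun ν ↦ ?_) hw
    · have h1 := (integrable_iff_integrableOn_disc ξ _).mp (hint ν)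
      rw [integrableOn_congr_fun (hpt ν) measurableSet_ball] at h1
      have h2 := h1.smul (4 * (4 * ξ.im) ^ (-k))⁻¹
      simp only [Pi.smul_def, smul_smul _ _ ((_ : ℝ) • (_ : ℂ)), inv_mul_cancel₀ hc,
        one_smul] at h2
      exact h2
    · have h1 := h0 ν
      rw [integral_eq_integral_disc ξ, setIntegral_congr_fun measurableSet_ball (hpt ν),
        integral_smul] at h1
      exact (smul_eq_zero.mp h1).resolve_left hc
  ext1 τ
  obtain ⟨h1, h2⟩ := discMap_div ξ τ
  have h3 := key _ h1
  simp only [hGdef, h2, Function.comp_apply, ofComplex_apply] at h3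
  refine (mul_eq_zero.mp h3).resolve_left ?_
  rw [Complex.cpow_eq_zero_iff]
  exact fun h ↦ sub_conj_ne_zero τ ξ h.1

end Cayley

end VVMF
end

noncomputable section

namespace VVMF

open Filter Topology MeasureTheory Set Metric

/-! ### Unfolding against a partition of unity. -/

section Unfolding

lemma countable_SL : Countable SL(2, ℤ) :=
  inferInstanceAs (Countable {A : Fin 2 → Fin 2 → ℤ // Matrix.det (Matrix.of A) = 1})

lemma measurePreserving_smul_SL (γ : SL(2, ℤ)) :
    MeasurePreserving (fun τ : ℍ ↦ γ • τ) volume volume :=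
  measurePreserving_smul (γ : GL (Fin 2) ℝ) (volume : Measure ℍ)

lemma measurableEmbedding_smul_SL (γ : SL(2, ℤ)) :
    MeasurableEmbedding fun τ : ℍ ↦ γ • τ :=
  measurableEmbedding_const_smul (γ : GL (Fin 2) ℝ)

/-- The unfolding identity for a weight `h` whose translates form a partition of unity. -/
lemma integral_weight_mul_tsum {G X : Type*} [Group G] [Countable G] [MulAction G X]
    [MeasurableSpace X] {μ : Measure X} (hmp : ∀ g : G, MeasurePreserving (fun x : X ↦ g • x) μ μ)
    (hme : ∀ g : G, MeasurableEmbedding fun x : X ↦ g • x)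
    {h : X → ℝ} (hm : Measurable h) (h0 : ∀ x, 0 ≤ h x)
    (h1 : ∀ x : X, HasSum (fun g : G ↦ h (g • x)) 1) {ψ : X → ℂ} (hψ : Integrable ψ μ) :
    ∫ x, h x • ∑' g : G, ψ (g • x) ∂μ = ∫ x, ψ x ∂μ := by
  have hle : ∀ x, h x ≤ 1 := fun x ↦ by
    have := le_hasSum (h1 x) 1 fun g _ ↦ h0 _
    simpa only [one_smul] using this
  have hintA : ∀ g : G, Integrable (fun x : X ↦ h (g • x) • ψ x) μ := fun g ↦
    hψ.bdd_smul 1 (hm.comp (hmp g).measurable).aestronglyMeasurable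
      (Eventually.of_forall fun x ↦ by
        rw [Function.comp_apply, Real.norm_of_nonneg (h0 _)]
        exact hle _)
  -- A translation by `g` moves the group element from `ψ` to the weight; measure invariance then
  -- equates the integrals.
  have hshift : ∀ g : G, (fun x : X ↦ h x • ψ (g • x)) =
      fun x ↦ (fun z : X ↦ h (g⁻¹ • z) • ψ z) (g • x) := fun g ↦ by
    ext x
    simp only [inv_smul_smul]
  have hshiftn : ∀ g : G, (fun x : X ↦ ‖h x • ψ (g • x)‖) =
      fun x ↦ (fun z : X ↦ ‖h (g⁻¹ • z) • ψ z‖) (g • x) := fun g ↦ by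
    ext x
    simp only [inv_smul_smul]
  have hintB : ∀ g : G, Integrable (fun x : X ↦ h x • ψ (g • x)) μ := fun g ↦ by
    rw [hshift]
    exact ((hmp g).integrable_comp_emb (hme g)).mpr (hintA g⁻¹)
  have heq : ∀ g : G, ∫ x : X, h x • ψ (g • x) ∂μ = ∫ x : X, h (g⁻¹ • x) • ψ x ∂μ := fun g ↦ by
    rw [hshift]
    exact (hmp g).integral_comp (hme g) fun z : X ↦ h (g⁻¹ • z) • ψ z
  have heqn : ∀ g : G, ∫ x : X, ‖h x • ψ (g • x)‖ ∂μ = ∫ x : X, ‖h (g⁻¹ • x) • ψ x‖ ∂μ :=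
    fun g ↦ by
      rw [hshiftn]
      exact (hmp g).integral_comp (hme g) fun z : X ↦ ‖h (g⁻¹ • z) • ψ z‖
  -- Finite partial sums of translated weights are at most `1`, so `∫ ‖ψ‖` bounds all partial sums.
  -- This justifies exchanging sum and integral.
  have hsumA : Summable fun g : G ↦ ∫ x : X, ‖h (g • x) • ψ x‖ ∂μ := by
    refine summable_of_sum_le (c := ∫ x, ‖ψ x‖ ∂μ)
      (fun g ↦ integral_nonneg fun x ↦ norm_nonneg _) fun s ↦ ?_
    rw [← integral_finsetSum _ fun g _ ↦ (hintA g).norm]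
    refine integral_mono (integrable_finsetSum _ fun g _ ↦ (hintA g).norm) hψ.norm fun x ↦ ?_
    simp only [norm_smul, Real.norm_of_nonneg (h0 _), ← Finset.sum_mul]
    exact mul_le_of_le_one_left (norm_nonneg _) (sum_le_hasSum s (fun g _ ↦ h0 _) (h1 x))
  have hsumB : Summable fun g : G ↦ ∫ x : X, ‖h x • ψ (g • x)‖ ∂μ := by
    simp only [heqn]
    exact (Equiv.inv G).summable_iff.mpr hsumA
  have eA := hasSum_integral_of_summable_integral_norm hintA hsumA
  have eB := hasSum_integral_of_summable_integral_norm hintB hsumB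
  simp only [heq] at eB
  have eB' := eB.unique ((Equiv.inv G).hasSum_iff.mpr eA)
  rw [show (fun x ↦ h x • ∑' g : G, ψ (g • x)) = fun x ↦ ∑' g : G, h x • ψ (g • x) from
      funext fun x ↦ (tsum_const_smul'' _).symm, eB']
  refine integral_congr_ae (Eventually.of_forall fun x ↦ ?_)
  have := ((h1 x).smul_const (ψ x)).tsum_eq
  rwa [one_smul] at this

end Unfolding

/-! ### An integrable weight whose translates sum to one. -/

section Weight

variable {Γ : Subgroup SL(2, ℤ)}

/-- A positive function on the upper half-plane with summable translates. -/
def bump (k : ℝ) (τ : ℍ) : ℝ :=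
  ‖(τ : ℂ) - (starRingEnd ℂ) (UpperHalfPlane.I : ℍ)‖ ^ (-k) * τ.im ^ (k / 2)

lemma bump_pos (k : ℝ) (τ : ℍ) : 0 < bump k τ :=
  mul_pos (Real.rpow_pos_of_pos (norm_pos_iff.mpr (sub_conj_ne_zero τ _)) _)
    (Real.rpow_pos_of_pos τ.im_pos _)

/-- The translates are the kernels of the convergence estimate, so their summability comes at no
extra cost. -/
lemma bump_smul (k : ℝ) (γ : SL(2, ℤ)) (τ : ℍ) :
    bump k (γ • τ) = kernelNorm UpperHalfPlane.I γ τ ^ (-k) * τ.im ^ (k / 2) := by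
  rw [bump, im_smul_rpow, kernelNorm, Real.mul_rpow (norm_nonneg _) (norm_nonneg _),
    mul_div_cancel₀ _ two_ne_zero]
  ring

lemma measurable_bump (k : ℝ) : Measurable (bump k) := by
  have h1 : Measurable fun τ : ℍ ↦ (τ : ℂ) := measurable_coe
  have h2 : Measurable fun τ : ℍ ↦ τ.im := continuous_im.measurable
  unfold bump
  fun_prop

lemma summable_bump {k : ℝ} (hk : 2 < k) (Γ : Subgroup SL(2, ℤ)) (τ : ℍ) :
    Summable fun γ : Γ ↦ bump k ((γ : SL(2, ℤ)) • τ) := by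
  simp only [bump_smul]
  refine Summable.mul_right _ ?_
  obtain ⟨C, hC, h⟩ := exists_kernelNorm_rpow_le (by linarith : 0 ≤ k) UpperHalfPlane.I |τ.re|
    τ.im_pos
  exact (((summable_entrySq_rpow hk).comp_injective
    Subtype.val_injective).mul_left C).of_nonneg_of_le
    (fun γ ↦ Real.rpow_nonneg (kernelNorm_pos _ _ _).le _) fun γ ↦ h γ τ ⟨le_rfl, le_rfl⟩

/-- A weight on the upper half-plane whose `Γ`-translates sum to `1`. -/
def weight (k : ℝ) (Γ : Subgroup SL(2, ℤ)) (τ : ℍ) : ℝ :=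
  bump k τ / ∑' γ : Γ, bump k ((γ : SL(2, ℤ)) • τ)

lemma tsum_bump_pos {k : ℝ} (hk : 2 < k) (Γ : Subgroup SL(2, ℤ)) (τ : ℍ) :
    0 < ∑' γ : Γ, bump k ((γ : SL(2, ℤ)) • τ) :=
  (summable_bump hk Γ τ).tsum_pos (fun _ ↦ (bump_pos _ _).le) 1 (bump_pos _ _)

lemma weight_pos {k : ℝ} (hk : 2 < k) (Γ : Subgroup SL(2, ℤ)) (τ : ℍ) : 0 < weight k Γ τ :=
  div_pos (bump_pos k τ) (tsum_bump_pos hk Γ τ)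

lemma measurable_weight (k : ℝ) (Γ : Subgroup SL(2, ℤ)) : Measurable (weight k Γ) := by
  have : Countable SL(2, ℤ) := countable_SL
  exact (measurable_bump k).div (Measurable.tsum fun γ : Γ ↦
    (measurable_bump k).comp (measurePreserving_smul_SL γ).measurable)

/-- The denominator is `Γ`-invariant, being a sum over the group. -/
lemma hasSum_weight {k : ℝ} (hk : 2 < k) (Γ : Subgroup SL(2, ℤ)) (τ : ℍ) :
    HasSum (fun γ : Γ ↦ weight k Γ ((γ : SL(2, ℤ)) • τ)) 1 := by
  have h1 : ∀ δ : Γ, ∑' γ : Γ, bump k ((γ : SL(2, ℤ)) • (δ : SL(2, ℤ)) • τ) =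
      ∑' γ : Γ, bump k ((γ : SL(2, ℤ)) • τ) := fun δ ↦ by
    rw [← (Equiv.mulRight δ).tsum_eq fun γ : Γ ↦ bump k ((γ : SL(2, ℤ)) • τ)]
    refine tsum_congr fun γ ↦ ?_
    rw [Equiv.coe_mulRight, Subgroup.coe_mul, SemigroupAction.mul_smul]
  simp only [weight, h1]
  have := (summable_bump hk Γ τ).hasSum.div_const (∑' γ : Γ, bump k ((γ : SL(2, ℤ)) • τ))
  rwa [div_self (tsum_bump_pos hk Γ τ).ne'] at this

lemma volume_verticalStrip_lt_top (A : ℝ) {B : ℝ} (hB : 0 < B) :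
    volume (verticalStrip A B) < ⊤ := by
  have h1 : IntegrableOn (fun p : ℝ × ℝ ↦ (1 : ℝ) * p.2 ^ (-2 : ℝ)) (Icc (-A) A ×ˢ Ici B) := by
    rw [IntegrableOn, Measure.volume_eq_prod, ← Measure.prod_restrict]
    refine Integrable.mul_prod (f := fun _ : ℝ ↦ (1 : ℝ)) (g := fun y : ℝ ↦ y ^ (-2 : ℝ)) ?_ ?_
    · exact integrableOn_const (by simp)
    · exact (integrableOn_Ici_iff_integrableOn_Ioi).mpr
        (integrableOn_Ioi_rpow_of_lt (by norm_num) hB)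
  have h2 : IntegrableOn (fun z : ℂ ↦ (1 : ℝ) * z.im ^ (-2 : ℝ))
      (Complex.measurableEquivRealProd ⁻¹' (Icc (-A) A ×ˢ Ici B)) :=
    (Complex.volume_preserving_equiv_real_prod.integrableOn_comp_preimage
      Complex.measurableEquivRealProd.measurableEmbedding).mpr h1
  rw [volume_eq_lintegral]
  refine lt_of_le_of_lt ?_ h2.2
  refine le_trans (le_of_eq ?_)
    (lintegral_mono_set (s := UpperHalfPlane.coe '' verticalStrip A B) ?_)
  · refine lintegral_congr fun z ↦ ?_
    beta_reduce
    rw [one_mul, enorm_eq_nnnorm, show (-2 : ℝ) = ((-2 : ℤ) : ℝ) by norm_num, Real.rpow_intCast]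
    congr 1
    ext
    simp [zpow_neg]
  · rintro _ ⟨τ, hτ, rfl⟩
    exact ⟨abs_le.mp hτ.1, hτ.2⟩

lemma volume_fd_lt_top : volume (ModularGroup.fd : Set ℍ) < ⊤ := by
  refine (measure_mono fun τ hτ ↦ ?_).trans_lt
    (volume_verticalStrip_lt_top (1 / 2) (by norm_num : (0 : ℝ) < 4 / 5))
  refine ⟨hτ.2, ?_⟩
  have := ModularGroup.three_le_four_mul_im_sq_of_mem_fd hτ
  nlinarith [τ.im_pos]

lemma measurableSet_fd : MeasurableSet (ModularGroup.fd : Set ℍ) := by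
  have h1 : Measurable fun τ : ℍ ↦ (τ : ℂ) := measurable_coe
  have h2 : Measurable fun τ : ℍ ↦ |τ.re| := by
    have := Complex.measurable_re.comp h1
    exact this.abs
  exact (measurableSet_le measurable_const (Complex.continuous_normSq.measurable.comp h1)).inter
    (measurableSet_le h2 measurable_const)

/-- The `Γ`-translates of `D`, a finite union of copies of the standard domain, cover `ℍ`. They may
overlap, hence only an inequality: the integral is at most that over `D` of the sum of all
translates of the weight, which is the finite area of `D`. -/
lemma integrable_weight {k : ℝ} (hk : 2 < k) (hfin : Γ.FiniteIndex) : Integrable (weight k Γ) := by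
  have : Countable SL(2, ℤ) := countable_SL
  have hmw := measurable_weight k Γ
  refine ⟨hmw.aestronglyMeasurable, ?_⟩
  set D : Set ℍ := ⋃ c : SL(2, ℤ) ⧸ Γ, (fun τ : ℍ ↦ c.out • τ) ⁻¹' ModularGroup.fd with hD
  have hDm : MeasurableSet D := MeasurableSet.iUnion fun c ↦
    (measurePreserving_smul_SL _).measurable measurableSet_fd
  have hDvol : volume D < ⊤ := by
    have := Fintype.ofFinite (SL(2, ℤ) ⧸ Γ)
    refine (measure_iUnion_fintype_le _ _).trans_lt (ENNReal.sum_lt_top.mpr fun c _ ↦ ?_)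
    rw [(measurePreserving_smul_SL _).measure_preimage measurableSet_fd.nullMeasurableSet]
    exact volume_fd_lt_top
  have hcover : (⋃ γ : Γ, (fun τ : ℍ ↦ (γ : SL(2, ℤ)) • τ) ⁻¹' D) = univ := by
    refine eq_univ_of_forall fun τ ↦ ?_
    obtain ⟨g, hg⟩ := ModularGroup.exists_smul_mem_fd τ
    obtain ⟨γ, c, h⟩ := exists_mul_inv_out Γ g⁻¹
    refine mem_iUnion.mpr ⟨γ⁻¹, mem_iUnion.mpr ⟨c, ?_⟩⟩
    have : g = c.out * ((γ⁻¹ : Γ) : SL(2, ℤ)) := by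
      rw [← inv_inv g, h]
      simp
    rw [this, SemigroupAction.mul_smul] at hg
    exact hg
  have hterm : ∀ γ : Γ, ∫⁻ τ in (fun τ : ℍ ↦ (γ : SL(2, ℤ)) • τ) ⁻¹' D, ‖weight k Γ τ‖ₑ =
      ∫⁻ τ in D, ‖weight k Γ (((γ⁻¹ : Γ) : SL(2, ℤ)) • τ)‖ₑ := fun γ ↦ by
    have := (measurePreserving_smul_SL γ).setLIntegral_comp_preimage_emb
      (measurableEmbedding_smul_SL γ)
      (fun z ↦ ‖weight k Γ (((γ⁻¹ : Γ) : SL(2, ℤ)) • z)‖ₑ) D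
    simpa only [Subgroup.coe_inv, inv_smul_smul] using this
  rw [hasFiniteIntegral_iff_enorm, ← setLIntegral_univ, ← hcover]
  refine (lintegral_iUnion_le _ _).trans_lt ?_
  simp only [hterm]
  have hsw := lintegral_tsum (μ := (volume : Measure ℍ).restrict D)
    (f := fun (γ : Γ) τ ↦ ‖weight k Γ (((γ⁻¹ : Γ) : SL(2, ℤ)) • τ)‖ₑ) fun γ ↦ (hmw.comp
      (measurePreserving_smul_SL _).measurable).enorm.aemeasurable
  rw [← hsw]
  refine lt_of_le_of_lt (lintegral_mono fun τ ↦ ?_) (by simpa using hDvol :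
    ∫⁻ _ in D, 1 < ⊤)
  refine ((Equiv.inv Γ).tsum_eq fun γ : Γ ↦ ‖weight k Γ ((γ : SL(2, ℤ)) • τ)‖ₑ).trans_le ?_
  have h1 := hasSum_weight hk Γ τ
  simp only [Real.enorm_of_nonneg (weight_pos hk Γ _).le]
  rw [← ENNReal.ofReal_tsum_of_nonneg (fun γ ↦ (weight_pos hk Γ _).le) h1.summable, h1.tsum_eq,
    ENNReal.ofReal_one]

end Weight

end VVMF
end

noncomputable section

namespace VVMF

open Filter Topology MeasureTheory Set Metric

/-! ### The Petersson product, unfolding and the spanning property. -/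

section Petersson

variable {p : ℕ} {Γ : Subgroup SL(2, ℤ)} {k : ℝ} {v : SL(2, ℤ) → ℂ} {ρ : Γ →* GL (Fin p) ℂ}

/-- The integrand of the Petersson product. -/
def peterssonDensity (k : ℝ) (F G : ℍ → Fin p → ℂ) (τ : ℍ) : ℂ :=
  (τ.im ^ k : ℝ) • (star (F τ) ⬝ᵥ G τ)

/-- The Petersson product of two cusp forms, with the fundamental domain of `Γ` replaced by a
weight. -/
def petersson (k : ℝ) (Γ : Subgroup SL(2, ℤ)) (F G : ℍ → Fin p → ℂ) : ℂ :=
  ∫ τ, weight k Γ τ • peterssonDensity k F G τ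

lemma norm_star_dotProduct_le (x y : Fin p → ℂ) : ‖star x ⬝ᵥ y‖ ≤ p * (‖x‖ * ‖y‖) := by
  refine (norm_sum_le _ _).trans ((Finset.sum_le_card_nsmul _ _ (‖x‖ * ‖y‖) fun j _ ↦ ?_).trans_eq
    (by simp))
  rw [norm_mul, Pi.star_apply, norm_star]
  gcongr <;> exact norm_le_pi_norm _ _

lemma norm_peterssonDensity_le (k : ℝ) (F G : ℍ → Fin p → ℂ) (τ : ℍ) :
    ‖peterssonDensity k F G τ‖ ≤ p * ((‖F τ‖ * τ.im ^ (k / 2)) * (‖G τ‖ * τ.im ^ (k / 2))) := by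
  have h : τ.im ^ k = τ.im ^ (k / 2) * τ.im ^ (k / 2) := by
    rw [← Real.rpow_add τ.im_pos, add_halves]
  rw [peterssonDensity, norm_smul, Real.norm_of_nonneg (Real.rpow_nonneg τ.im_pos.le _), h]
  calc _ ≤ τ.im ^ (k / 2) * τ.im ^ (k / 2) * (p * (‖F τ‖ * ‖G τ‖)) := by
        have := τ.im_pos
        gcongr
        exact norm_star_dotProduct_le _ _
    _ = _ := by ring

lemma continuous_peterssonDensity {F G : ℍ → Fin p → ℂ} (hF : Continuous F) (hG : Continuous G) :
    Continuous (peterssonDensity k F G) := by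
  refine Continuous.smul (continuous_im.rpow_const fun τ ↦ Or.inl τ.im_pos.ne') ?_
  exact Continuous.dotProduct hF.star hG

lemma continuous_of_mem_cuspForms {F : ℍ → Fin p → ℂ} (hF : F ∈ cuspForms k v ρ) :
    Continuous F :=
  continuous_pi fun j ↦ (hF.1 j).1.continuous

lemma continuous_ellipticSeed (ν : ℕ) (ξ : ℍ) (u : Fin p → ℂ) :
    Continuous (ellipticSeed k ν ξ u) :=
  continuous_pi fun j ↦ (mdifferentiable_ellipticSeed ν ξ u j).continuous

/-- The density is bounded because `|F| y^(k/2)` and `|G| y^(k/2)` are, and the weight is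
integrable. -/
lemma integrable_weight_smul_peterssonDensity (hk : 2 < k) (hv : IsMultiplierSystem k v)
    (hfin : Γ.FiniteIndex) {hΓ : -1 ∈ Γ} (hρ : IsUnitary ρ) (hnormal : IsNormal v hΓ ρ)
    {F G : ℍ → Fin p → ℂ} (hF : F ∈ cuspForms k v ρ) (hG : G ∈ cuspForms k v ρ) :
    Integrable fun τ ↦ weight k Γ τ • peterssonDensity k F G τ := by
  obtain ⟨A, hA⟩ := exists_bound_of_mem_cuspForms hk hv hfin hρ hnormal hF
  obtain ⟨B, hB⟩ := exists_bound_of_mem_cuspForms hk hv hfin hρ hnormal hG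
  refine (integrable_weight hk hfin).smul_bdd (p * (A * B)) (continuous_peterssonDensity
    (continuous_of_mem_cuspForms hF) (continuous_of_mem_cuspForms hG)).aestronglyMeasurable
    (Eventually.of_forall fun τ ↦ (norm_peterssonDensity_le k F G τ).trans ?_)
  have h0 : 0 ≤ ‖F τ‖ * τ.im ^ (k / 2) := by have := τ.im_pos; positivity
  have h1 : 0 ≤ ‖G τ‖ * τ.im ^ (k / 2) := by have := τ.im_pos; positivity
  have := mul_le_mul (hA τ) (hB τ) h1 (h0.trans (hA τ))
  gcongr

lemma star_mulVec_dotProduct_mulVec {U : Matrix (Fin p) (Fin p) ℂ}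
    (hU : U ∈ Matrix.unitaryGroup (Fin p) ℂ) (x y : Fin p → ℂ) :
    star (U.mulVec x) ⬝ᵥ U.mulVec y = star x ⬝ᵥ y := by
  rw [Matrix.star_mulVec, ← Matrix.dotProduct_mulVec, Matrix.mulVec_mulVec,
    ← Matrix.star_eq_conjTranspose, Matrix.mem_unitaryGroup_iff'.mp hU, Matrix.one_mulVec]

/-- A cusp form is invariant, so its product with a translate is the translate of the product. -/
lemma peterssonDensity_slashRep (hv : IsMultiplierSystem k v) (hρ : IsUnitary ρ)
    {F : ℍ → Fin p → ℂ} (hF : F ∈ cuspForms k v ρ) (γ : Γ) (f : ℍ → Fin p → ℂ) (τ : ℍ) :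
    peterssonDensity k (slashRep k v ρ γ f) F τ =
      peterssonDensity k f F ((γ : SL(2, ℤ)) • τ) := by
  have h1 : F τ = ((ρ γ)⁻¹ : GL (Fin p) ℂ).val.mulVec (slash k v γ F τ) := by
    rw [hF.2 γ τ, Matrix.mulVec_mulVec, ← Units.val_mul, inv_mul_cancel, Units.val_one,
      Matrix.one_mulVec]
  have h2 : star ((v γ)⁻¹ * denom (γ : SL(2, ℤ)) τ ^ (-(k : ℂ))) *
      ((v γ)⁻¹ * denom (γ : SL(2, ℤ)) τ ^ (-(k : ℂ))) =
        ((‖denom (γ : SL(2, ℤ)) τ‖ ^ (-(2 * k)) : ℝ) : ℂ) := by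
    rw [← starRingEnd_apply, ← Complex.normSq_eq_conj_mul_self, Complex.normSq_eq_norm_sq, norm_mul,
      norm_inv, hv.norm_eq_one, ← Complex.ofReal_neg, Complex.norm_cpow_real, inv_one, one_mul,
      ← Real.rpow_mul_natCast (norm_nonneg _)]
    congr 3
    push_cast
    ring
  rw [peterssonDensity, peterssonDensity, slashRep]
  conv_lhs => rw [h1]
  rw [star_mulVec_dotProduct_mulVec (hρ.inv_mem γ), slash, slash, star_smul, smul_dotProduct,
    dotProduct_smul, smul_smul, h2, im_smul_rpow, Complex.coe_smul, smul_smul, mul_comm]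

lemma hasSum_peterssonDensity {ι : Type*} {f : ι → ℍ → Fin p → ℂ} {s F : ℍ → Fin p → ℂ} {τ : ℍ}
    (h : HasSum (fun i ↦ f i τ) (s τ)) :
    HasSum (fun i ↦ peterssonDensity k (f i) F τ) (peterssonDensity k s F τ) := by
  refine HasSum.const_smul _ (hasSum_sum fun j _ ↦ ?_)
  exact ((Pi.hasSum.mp h j).star).mul_right (F τ j)

lemma peterssonDensity_ellipticSeed (ν : ℕ) (ξ : ℍ) (j : Fin p) (F : ℍ → Fin p → ℂ) :
    peterssonDensity k (ellipticSeed k ν ξ (Pi.single j 1)) F = fun τ : ℍ ↦ (τ.im ^ k : ℝ) •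
      ((starRingEnd ℂ) (((τ : ℂ) - ξ) ^ ν / ((τ : ℂ) - (starRingEnd ℂ) ξ) ^ ((ν : ℂ) + k)) *
        F τ j) := by
  ext1 τ
  rw [peterssonDensity, ellipticSeed, star_smul, smul_dotProduct, ← Pi.single_star, star_one,
    single_one_dotProduct, smul_eq_mul]
  rfl

/-- With `|F| y^(k/2)` bounded, half of `y ^ k` is left for the seed, and `integrable_kernel`
applies. -/
lemma integrable_peterssonDensity_ellipticSeed (hk : 2 < k) (hv : IsMultiplierSystem k v)
    (hfin : Γ.FiniteIndex) {hΓ : -1 ∈ Γ} (hρ : IsUnitary ρ) (hnormal : IsNormal v hΓ ρ)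
    {F : ℍ → Fin p → ℂ} (hF : F ∈ cuspForms k v ρ) (ν : ℕ) (ξ : ℍ) (u : Fin p → ℂ) :
    Integrable (peterssonDensity k (ellipticSeed k ν ξ u) F) := by
  obtain ⟨A, hA⟩ := exists_bound_of_mem_cuspForms hk hv hfin hρ hnormal hF
  refine ((integrable_kernel hk ξ).const_mul (p * (‖u‖ * A))).mono' (continuous_peterssonDensity
    (continuous_ellipticSeed ν ξ u) (continuous_of_mem_cuspForms hF)).aestronglyMeasurable
    (Eventually.of_forall fun τ ↦ (norm_peterssonDensity_le k _ F τ).trans ?_)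
  have := τ.im_pos
  have h0 : 0 ≤ ‖F τ‖ * τ.im ^ (k / 2) := by positivity
  calc _ ≤ p * ((‖(τ : ℂ) - (starRingEnd ℂ) ξ‖ ^ (-k) * ‖u‖ * τ.im ^ (k / 2)) * A) := by
        gcongr
        · exact norm_ellipticSeed_le ν ξ u τ
        · exact hA τ
    _ = _ := by ring

/-- The product of a cusp form with an elliptic Poincaré series unfolds. -/
lemma petersson_groupSeries (hk : 2 < k) (hv : IsMultiplierSystem k v)
    (hfin : Γ.FiniteIndex) {hΓ : -1 ∈ Γ} (hρ : IsUnitary ρ) (hnormal : IsNormal v hΓ ρ)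
    {F : ℍ → Fin p → ℂ} (hF : F ∈ cuspForms k v ρ) (ν : ℕ) (ξ : ℍ) (u : Fin p → ℂ) :
    petersson k Γ (groupSeries k v ρ ν ξ u) F =
      ∫ τ, peterssonDensity k (ellipticSeed k ν ξ u) F τ := by
  have : Countable SL(2, ℤ) := countable_SL
  rw [← integral_weight_mul_tsum (G := Γ) (fun γ ↦ measurePreserving_smul_SL γ)
    (fun γ ↦ measurableEmbedding_smul_SL γ) (measurable_weight k Γ)
    (fun τ ↦ (weight_pos hk Γ τ).le) (hasSum_weight hk Γ)
    (integrable_peterssonDensity_ellipticSeed hk hv hfin hρ hnormal hF ν ξ u), petersson]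
  congr 1 with τ
  congr 1
  have := hasSum_peterssonDensity (k := k) (F := F)
    (summable_norm_slashRep hk hv hρ ν ξ u τ).of_norm.hasSum (s := groupSeries k v ρ ν ξ u)
  rw [← this.tsum_eq]
  exact tsum_congr fun γ ↦ peterssonDensity_slashRep hv hρ hF γ _ τ

lemma eq_zero_of_integral_peterssonDensity (hk : 2 < k) (hv : IsMultiplierSystem k v)
    (hfin : Γ.FiniteIndex) {hΓ : -1 ∈ Γ} (hρ : IsUnitary ρ) (hnormal : IsNormal v hΓ ρ)
    {F : ℍ → Fin p → ℂ} (hF : F ∈ cuspForms k v ρ) (ξ : ℍ) (h : ∀ (ν : ℕ) (j : Fin p),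
      ∫ τ, peterssonDensity k (ellipticSeed k ν ξ (Pi.single j 1)) F τ = 0) : F = 0 := by
  have hj : ∀ j, (fun τ ↦ F τ j) = 0 := fun j ↦ by
    refine eq_zero_of_integral_seed_eq_zero hk ξ (hF.1 j).1 (fun ν ↦ ?_) fun ν ↦ ?_
    · rw [← peterssonDensity_ellipticSeed]
      exact integrable_peterssonDensity_ellipticSeed hk hv hfin hρ hnormal hF ν ξ _
    · rw [← h ν j, peterssonDensity_ellipticSeed]
  ext τ j
  exact congrFun (hj j) τ

lemma star_dotProduct_self_eq (x : Fin p → ℂ) : star x ⬝ᵥ x = ((∑ j, ‖x j‖ ^ 2 : ℝ) : ℂ) := by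
  rw [dotProduct, Complex.ofReal_sum]
  refine Finset.sum_congr rfl fun j _ ↦ ?_
  rw [Pi.star_apply, ← starRingEnd_apply, ← Complex.normSq_eq_conj_mul_self,
    Complex.normSq_eq_norm_sq]

lemma petersson_self (F : ℍ → Fin p → ℂ) : petersson k Γ F F =
    ((∫ τ : ℍ, weight k Γ τ * (τ.im ^ k * ∑ j, ‖F τ j‖ ^ 2) : ℝ) : ℂ) := by
  refine Eq.trans ?_ integral_ofReal
  rw [petersson]
  congr 1 with τ
  rw [peterssonDensity, star_dotProduct_self_eq, Complex.real_smul, Complex.real_smul]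
  push_cast
  rfl

/-- Positivity of the weight gives `F = 0` almost everywhere, so all pairings with seeds vanish and
the disc argument gives `F = 0` everywhere. -/
lemma eq_zero_of_petersson_self (hk : 2 < k) (hv : IsMultiplierSystem k v)
    (hfin : Γ.FiniteIndex) {hΓ : -1 ∈ Γ} (hρ : IsUnitary ρ) (hnormal : IsNormal v hΓ ρ)
    {F : ℍ → Fin p → ℂ} (hF : F ∈ cuspForms k v ρ) (h : petersson k Γ F F = 0) : F = 0 := by
  have hint := integrable_weight_smul_peterssonDensity hk hv hfin hρ hnormal hF hF
  have hn : ∀ τ : ℍ, ‖weight k Γ τ • peterssonDensity k F F τ‖ =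
      weight k Γ τ * (τ.im ^ k * ∑ j, ‖F τ j‖ ^ 2) := fun τ ↦ by
    rw [peterssonDensity, star_dotProduct_self_eq, norm_smul, norm_smul, Complex.norm_real,
      Real.norm_of_nonneg (weight_pos hk Γ τ).le, Real.norm_of_nonneg (Real.rpow_nonneg
        τ.im_pos.le _), Real.norm_of_nonneg (Finset.sum_nonneg fun j _ ↦ sq_nonneg _)]
  have hi := hint.norm
  simp only [hn] at hi
  rw [petersson_self, Complex.ofReal_eq_zero, integral_eq_zero_iff_of_nonneg (fun τ ↦ by
    rw [← hn]; exact norm_nonneg _) hi] at h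
  have hae : ∀ᵐ τ : ℍ, F τ = 0 := by
    filter_upwards [h] with τ hτ
    have h1 : ∑ j, ‖F τ j‖ ^ 2 = 0 := by
      simpa [(weight_pos hk Γ τ).ne', (Real.rpow_pos_of_pos τ.im_pos k).ne'] using hτ
    ext j
    have := (Finset.sum_eq_zero_iff_of_nonneg fun j _ ↦ sq_nonneg _).mp h1 j (Finset.mem_univ j)
    simpa using this
  refine eq_zero_of_integral_peterssonDensity hk hv hfin hρ hnormal hF UpperHalfPlane.I
    fun ν j ↦ integral_eq_zero_of_ae ?_
  filter_upwards [hae] with τ hτ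
  simp [peterssonDensity, hτ]

/-- The Petersson inner product on the space of cusp forms. -/
abbrev peterssonCore (hk : 2 < k) (hv : IsMultiplierSystem k v)
    (hfin : Γ.FiniteIndex) {hΓ : -1 ∈ Γ} (hρ : IsUnitary ρ) (hnormal : IsNormal v hΓ ρ) :
    InnerProductSpace.Core ℂ (cuspForms k v ρ) where
  inner F G := petersson k Γ (F : ℍ → Fin p → ℂ) G
  conj_inner_symm F G := by
    rw [petersson, petersson, ← integral_conj]
    congr 1 with τ
    have : star (star (G.1 τ) ⬝ᵥ F.1 τ) = star (F.1 τ) ⬝ᵥ G.1 τ := by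
      rw [← Matrix.star_dotProduct_star, star_star, dotProduct_comm]
    rw [peterssonDensity, peterssonDensity, ← this, starRingEnd_apply, star_smul, star_smul,
      star_trivial, star_trivial]
  re_inner_nonneg F := by
    rw [petersson_self]
    refine integral_nonneg fun τ ↦ mul_nonneg (weight_pos hk Γ τ).le (mul_nonneg
      (Real.rpow_nonneg τ.im_pos.le _) (Finset.sum_nonneg fun j _ ↦ sq_nonneg _))
  add_left F G H := by
    rw [petersson, petersson, petersson, ← integral_add
      (integrable_weight_smul_peterssonDensity hk hv hfin hρ hnormal F.2 H.2)
      (integrable_weight_smul_peterssonDensity hk hv hfin hρ hnormal G.2 H.2)]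
    congr 1 with τ
    simp only [peterssonDensity, Submodule.coe_add, Pi.add_apply, star_add, add_dotProduct,
      smul_add]
  smul_left F G c := by
    rw [petersson, petersson, ← integral_const_mul]
    congr 1 with τ
    simp only [peterssonDensity, Submodule.coe_smul, Pi.smul_apply, star_smul, smul_dotProduct,
      smul_eq_mul, starRingEnd_apply, mul_smul_comm]
  definite F h := Subtype.ext (eq_zero_of_petersson_self hk hv hfin hρ hnormal F.2 h)

/-- Finite dimension is essential: in general a trivial orthogonal complement gives only density. -/
lemma eq_top_of_forall_inner_eq_zero {V : Type*} [AddCommGroup V] [Module ℂ V]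
    [FiniteDimensional ℂ V] (c : InnerProductSpace.Core ℂ V) (W : Submodule ℂ V)
    (h : ∀ x, (∀ w ∈ W, c.inner w x = 0) → x = 0) : W = ⊤ := by
  let _ : NormedAddCommGroup V := c.toNormedAddCommGroup
  let _ : InnerProductSpace ℂ V := InnerProductSpace.ofCore c.toCore
  rw [← Submodule.orthogonal_eq_bot_iff, Submodule.eq_bot_iff]
  exact fun x hx ↦ h x fun w hw ↦ hx w hw

lemma cuspForms_eq_span (hk : 2 < k) (hv : IsMultiplierSystem k v)
    (hfin : Γ.FiniteIndex) {hΓ : -1 ∈ Γ} (hρ : IsUnitary ρ) (hnormal : IsNormal v hΓ ρ) (ξ : ℍ) :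
    cuspForms k v ρ = Submodule.span ℂ {Φ : ℍ → Fin p → ℂ | ∃ (ν : ℕ) (j : Fin p),
      Φ = ellipticPoincare k v hΓ ρ ν ξ (Pi.single j 1)} := by
  refine le_antisymm ?_ (Submodule.span_le.mpr ?_)
  · have := finiteDimensional_cuspForms hk hv hfin hρ hnormal
    rw [← Submodule.comap_subtype_eq_top]
    refine eq_top_of_forall_inner_eq_zero (peterssonCore hk hv hfin hρ hnormal) _ fun F hF ↦ ?_
    refine Subtype.ext (eq_zero_of_integral_peterssonDensity hk hv hfin hρ hnormal F.2 ξ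
      fun ν j ↦ ?_)
    rw [← petersson_groupSeries hk hv hfin hρ hnormal F.2]
    refine hF ⟨_, groupSeries_mem_cuspForms hk hv hfin hρ hnormal ν ξ _⟩
      (Submodule.mem_comap.mpr ?_)
    -- Orthogonality is tested on the sums over `Γ`, which lie in the span as scalar multiples of
    -- the Poincaré series.
    have h := Submodule.smul_mem _ (Nat.card (Subgroup.zpowers (⟨-1, hΓ⟩ : Γ)) : ℂ)
      (Submodule.subset_span ⟨ν, j, rfl⟩ : _ ∈ Submodule.span ℂ {Φ : ℍ → Fin p → ℂ |
        ∃ (ν : ℕ) (j : Fin p), Φ = ellipticPoincare k v hΓ ρ ν ξ (Pi.single j 1)})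
    rwa [← groupSeries_eq_smul hk hv hρ hnormal] at h
  · rintro _ ⟨ν, j, rfl⟩
    exact ellipticPoincare_mem_cuspForms hk hv hfin hρ hnormal ν ξ _

end Petersson

end VVMF
end

theorem corollary6p2 (p : ℕ) (hp : 0 < p) (k : ℝ) (hk : 2 < k)
    (v : SL(2, ℤ) → ℂ) (hv : VVMF.IsMultiplierSystem k v)
    (Γ : Subgroup SL(2, ℤ)) (hfin : Γ.FiniteIndex) (hΓ : -1 ∈ Γ)
    (ρ : Γ →* GL (Fin p) ℂ) (hunitary : VVMF.IsUnitary ρ) (hnormal : VVMF.IsNormal v hΓ ρ)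
    (ξ : ℍ) :
    (∀ (ν : ℕ) (j : Fin p) (τ : ℍ),
      Summable fun c : Quotient (QuotientGroup.rightRel (Subgroup.zpowers (⟨-1, hΓ⟩ : Γ))) ↦
        ‖VVMF.slashRep k v ρ c.out (VVMF.ellipticSeed k ν ξ (Pi.single j 1)) τ‖) ∧
    VVMF.cuspForms k v ρ =
      Submodule.span ℂ {Φ : ℍ → Fin p → ℂ | ∃ (ν : ℕ) (j : Fin p),
        Φ = VVMF.ellipticPoincare k v hΓ ρ ν ξ (Pi.single j 1)} := by
  -- Coset representatives are distinct elements of `Γ`, so the series is a subfamily of the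
  -- absolutely convergent sum over `Γ`.
  exact ⟨fun ν j τ ↦
    (VVMF.summable_norm_slashRep hk hv hunitary ν ξ (Pi.single j 1) τ).comp_injective
      Quotient.out_injective, VVMF.cuspForms_eq_span hk hv hfin hunitary hnormal ξ⟩
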